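/- **Definitions.** A *BMW-presentation* is a group presentation $\Gamma=\langle A\cup X\mid R\rangle$ with $A$, $X$ disjoint finite sets such that: (BMW1) $R=R_2\cup R_4$, where every $r\in R_2$ is of the form $t^2$ with $t\in A\cup X$, and every $r\in R_4$ is of the form $axa'x'$ with $a,a'\in A\cup A^{-1}$ and $x,x'\in X\cup X^{-1}$; (BMW2) for all $a\in A\cup A^{-1}$ and $x\in X\cup X^{-1}$ there is a unique pair $(a',x')$ with $a'\in A\cup A^{-1}$ and $x'\in X\cup X^{-1}$ such that one of $axa'x'$, $\ a'x'ax$, $\ a^{-1}x'^{-1}a'^{-1}x^{-1}$, $\ a'^{-1}x^{-1}a^{-1}x'^{-1}$ belongs to $R_4$. Here all letters and words are viewed in the group $\langle A\cup X\mid R_2\rangle$. Its *degree* is $(m,n)$, where $m=2\,|\{a\in A: a^2\notin R\}|+|\{a\in A: a^2\in R\}|$ and $n=2\,|\{x\in X: x^2\notin R\}|+|\{x\in X: x^2\in R\}|$. A group $G$ with a finite generating set $S$ is a *BMW-group of degree $(M,N)$* if its Cayley graph with respect to $S$ is isomorphic to the Cartesian product of an $M$-regular tree $T$ and an $N$-regular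 tree $T'$, in such a way that the image of $G\to\mathrm{Aut}(T\times T')$ is contained in $\mathrm{Aut}(T)\times\mathrm{Aut}(T')$. It is *reducible* if it has a finite index subgroup that splits as a direct product of two free groups of rank $\geq 1$, and *irreducible* otherwise. **Proposition (D. Wise).** Let $\Gamma=\langle A\cup X\mid R\rangle$ be a BMW-presentation of degree $(m,n)$, with $m,n\geq 2$, of an irreducible group. Let $A\to\bar A$, $a\mapsto\bar a$, be a bijection onto a set $\bar A$ disjoint from $A\cup X$, put $\overline{a^{-1}}=\bar a^{-1}$, and set $$\bar R_2=\{\bar a^2\mid a\in A,\ a^2\in R\},\qquad \bar R_4=\{\bar a x\bar a'x'\mid a,a'\in A\cup A^{-1},\ x,x'\in X\cup X^{-1},\ axa'x'\in R\},$$ $\bar R=\bar R_2\cup\bar R_4$ and $\Lambda=\langle A\cup\bar A\cup X\mid R\cup\bar R\rangle$. Then: 1. $\Lambda\cong\Gamma*_{\langle X\rangle}\Gamma$, by an isomorphism under which the homomorphisms $\Gamma\to\Lambda$ given by $a\mapsto a,\ x\mapsto x$ and by $a\mapsto\bar a,\ x\mapsto x$ become the inclusions of the two factors. 2. $\langle A\cup\bar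 A\cup X\mid R\cup\bar R\rangle$ is a BMW-presentation of degree $(2m,n)$, and $\Lambda$ is a BMW-group of degree $(2m,n)$ with respect to the generating set $A\cup\bar A\cup X$. 3. $\Lambda$ is irreducible and is not residually finite. More precisely, there exist $a,b\in A\cup A^{-1}$, distinct as elements of $\Gamma$, such that $ab^{-1}\bar b\bar a^{-1}$ lies in every finite index subgroup of $\Lambda$. -/

import Mathlib

namespace BMW

universe u v

/-! ### BMW-presentations -/

/-- For a family `f` of elements of a group, the set `{f i} ∪ {(f i)⁻¹}`; with `f` the family of
the generators `A` (or `X`), this is the set `A ∪ A⁻¹` (or `X ∪ X⁻¹`) inside the group `G`. -/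
def signedSet {ι G : Type*} [Group G] (f : ι → G) : Set G :=
  {g | ∃ i, g = f i ∨ g = (f i)⁻¹}

section Presentation

variable {A : Type u} {X : Type v} (R : Set (FreeGroup (A ⊕ X)))

/-- `R₂`: the relators in `R` of the form `t²`, with `t` a generator. -/
def relatorsTwo : Set (FreeGroup (A ⊕ X)) :=
  {r | r ∈ R ∧ ∃ t : A ⊕ X, r = FreeGroup.of t ^ 2}

/-- `R₄`: the relators in `R` of the form `a x a' x'` with `a, a' ∈ A ∪ A⁻¹` and
`x, x' ∈ X ∪ X⁻¹`. -/
def relatorsFour : Set (FreeGroup (A ⊕ X)) :=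
  {r | r ∈ R ∧
    ∃ a ∈ signedSet (fun a : A => FreeGroup.of (Sum.inl a : A ⊕ X)),
    ∃ x ∈ signedSet (fun x : X => FreeGroup.of (Sum.inr x : A ⊕ X)),
    ∃ a' ∈ signedSet (fun a : A => FreeGroup.of (Sum.inl a : A ⊕ X)),
    ∃ x' ∈ signedSet (fun x : X => FreeGroup.of (Sum.inr x : A ⊕ X)),
      r = a * x * a' * x'}

/-- The image of `R₄` in the group `⟨A ∪ X | R₂⟩`. -/
def relatorsFourImage : Set (PresentedGroup (relatorsTwo R)) :=
  PresentedGroup.mk (relatorsTwo R) '' relatorsFour R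

/-- `⟨A ∪ X | R⟩` is a BMW-presentation (for finite `A` and `X`).

The second condition is read in the group `⟨A ∪ X | R₂⟩`. It says that every pair `(a, x)` has a
unique completion `(a', x')` such that the word `a x a' x'` is, up to inversion and to cyclic
permutation, one of the relators in `R₄`. -/
def IsBMWPresentation : Prop :=
  (∀ r ∈ R, r ∈ relatorsTwo R ∨ r ∈ relatorsFour R) ∧
  ∀ a ∈ signedSet (fun a : A => (PresentedGroup.of (Sum.inl a) : PresentedGroup (relatorsTwo R))),
  ∀ x ∈ signedSet (fun x : X => (PresentedGroup.of (Sum.inr x) : PresentedGroup (relatorsTwo R))),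
    ∃! p : PresentedGroup (relatorsTwo R) × PresentedGroup (relatorsTwo R),
      p.1 ∈ signedSet
        (fun a : A => (PresentedGroup.of (Sum.inl a) : PresentedGroup (relatorsTwo R))) ∧
      p.2 ∈ signedSet
        (fun x : X => (PresentedGroup.of (Sum.inr x) : PresentedGroup (relatorsTwo R))) ∧
      (a * x * p.1 * p.2 ∈ relatorsFourImage R ∨
        p.1 * p.2 * a * x ∈ relatorsFourImage R ∨
        a⁻¹ * p.2⁻¹ * p.1⁻¹ * x⁻¹ ∈ relatorsFourImage R ∨
        p.1⁻¹ * x⁻¹ * a⁻¹ * p.2⁻¹ ∈ relatorsFourImage R)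

/-- The first degree of the presentation: each `a ∈ A` with `a² ∈ R` counts once, and every
other `a ∈ A` counts twice. -/
noncomputable def degreeA : ℕ :=
  2 * {a : A | FreeGroup.of (Sum.inl a) ^ 2 ∉ R}.ncard
    + {a : A | FreeGroup.of (Sum.inl a) ^ 2 ∈ R}.ncard

/-- The second degree of the presentation: each `x ∈ X` with `x² ∈ R` counts once, and every
other `x ∈ X` counts twice. -/
noncomputable def degreeX : ℕ :=
  2 * {x : X | FreeGroup.of (Sum.inr x) ^ 2 ∉ R}.ncard
    + {x : X | FreeGroup.of (Sum.inr x) ^ 2 ∈ R}.ncard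

end Presentation

/-! ### BMW-groups -/

/-- With respect to the generating set `S`, the group `G` is a BMW-group of degree `(M, N)`: its
Cayley graph is isomorphic to the Cartesian product of an `M`-regular tree and an `N`-regular tree,
and the action of `G` on the Cayley graph (by left multiplication) is through automorphisms of the
product that preserve each of the two factors. -/
def IsBMWGroup (G : Type*) [Group G] (S : Set G) (M N : ℕ) : Prop :=
  S.Finite ∧ Subgroup.closure S = ⊤ ∧
  ∃ (V W : Type) (T : SimpleGraph V) (T' : SimpleGraph W),
    T.IsTree ∧ T'.IsTree ∧
    (∀ v, (T.neighborSet v).encard = M) ∧ (∀ w, (T'.neighborSet w).encard = N) ∧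
    ∃ e : SimpleGraph.mulCayley S ≃g T.boxProd T',
      ∀ g : G, ∃ (φ : T ≃g T) (ψ : T' ≃g T'),
        ∀ h : G, e (g * h) = (φ (e h).1, ψ (e h).2)

/-- A group is reducible if it has a finite index subgroup that splits as a direct product of two
free groups of rank at least one. -/
def IsReducible (G : Type*) [Group G] : Prop :=
  ∃ H : Subgroup G, H.FiniteIndex ∧ ∃ S T : Type, Nonempty S ∧ Nonempty T ∧
    Nonempty (H ≃* FreeGroup S × FreeGroup T)

/-! ### The doubled presentation -/

section Double

variable {A : Type u} {X : Type v}

/-- The inclusion of the generators `A ∪ X` in `A ∪ Ā ∪ X`. The type `A ⊕ A` stands for `A ∪ Ā`: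
the left summand is `A` and the right summand is `Ā`. -/
def origGen : A ⊕ X → (A ⊕ A) ⊕ X :=
  Sum.map Sum.inl id

/-- The map `A ∪ X → A ∪ Ā ∪ X` with `a ↦ ā` for `a ∈ A` and `x ↦ x` for `x ∈ X`. -/
def barGen : A ⊕ X → (A ⊕ A) ⊕ X :=
  Sum.map Sum.inr id

variable (R : Set (FreeGroup (A ⊕ X)))

/-- `R̄₂ = {ā² | a ∈ A, a² ∈ R}`. -/
def barRelatorsTwo : Set (FreeGroup ((A ⊕ A) ⊕ X)) :=
  {r | ∃ a : A, FreeGroup.of (Sum.inl a) ^ 2 ∈ R ∧ r = FreeGroup.of (Sum.inl (Sum.inr a)) ^ 2}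

/-- `R̄₄ = {ā x ā' x' | a, a' ∈ A ∪ A⁻¹, x, x' ∈ X ∪ X⁻¹, a x a' x' ∈ R}`. -/
def barRelatorsFour : Set (FreeGroup ((A ⊕ A) ⊕ X)) :=
  FreeGroup.map barGen '' relatorsFour R

/-- The relators `R ∪ R̄` of the doubled presentation, where `R̄ = R̄₂ ∪ R̄₄`. -/
def doubleRelators : Set (FreeGroup ((A ⊕ A) ⊕ X)) :=
  FreeGroup.map origGen '' R ∪ (barRelatorsTwo R ∪ barRelatorsFour R)

/-- The homomorphism `⟨A ∪ X | R⟩ → ⟨A ∪ Ā ∪ X | R ∪ R̄⟩` with `a ↦ a` and `x ↦ x`. -/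
def origHom : PresentedGroup R →* PresentedGroup (doubleRelators R) :=
  PresentedGroup.map (FreeGroup.map origGen) fun r hr => Or.inl ⟨r, hr, rfl⟩

variable {R}

theorem mapsTo_bar (hR : IsBMWPresentation R) :
    R.MapsTo (FreeGroup.map barGen) (doubleRelators R) := by
  intro r hr
  rcases hR.1 r hr with ⟨_, t, ht⟩ | h4
  · subst ht
    cases t with
    | inl a => exact Or.inr (Or.inl ⟨a, hr, by simp [barGen]⟩)
    | inr x => exact Or.inl ⟨_, hr, by simp [barGen, origGen]⟩
  · exact Or.inr (Or.inr ⟨r, h4, rfl⟩)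

/-- The homomorphism `⟨A ∪ X | R⟩ → ⟨A ∪ Ā ∪ X | R ∪ R̄⟩` with `a ↦ ā` and `x ↦ x`. -/
def barHom (hR : IsBMWPresentation R) :
    PresentedGroup R →* PresentedGroup (doubleRelators R) :=
  PresentedGroup.map (FreeGroup.map barGen) (mapsTo_bar hR)

variable (R)

/-- The subgroup `⟨X⟩` of `⟨A ∪ X | R⟩`. -/
def subgroupX : Subgroup (PresentedGroup R) :=
  Subgroup.closure (Set.range fun x : X => PresentedGroup.of (Sum.inr x))

/-- The free amalgamated product `Γ *_{⟨X⟩} Γ` of two copies (indexed by `false` and `true`) of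
`Γ = ⟨A ∪ X | R⟩` over the subgroup `⟨X⟩`. -/
abbrev DoubleOverX : Type (max u v) :=
  Monoid.PushoutI (fun _ : Bool => (subgroupX R).subtype)

end Double

end BMW

/-!
Write `Γ = ⟨A ∪ X | R⟩` and `Λ` for the group of the doubled presentation.

*BMW-presentations give BMW-groups.* Let `L` and `M` be the sets of signed letters `A ∪ A⁻¹` and
`X ∪ X⁻¹`. The second axiom says that every product `x a` can be rewritten in a unique way as `b y`
(`SquareData`). The group `WordGroup L` generated by `L` with inversion as its only relations has
a tree as its Cayley graph, by the normal form of reduced words, and the rewriting rule, applied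
letter by letter, lets every `x` in `M` act on it (`SquareData.slide`). Together with left
multiplication by `L` this is an action of `Γ` on the tree of `L`, and dually `Γ` acts on the tree
of `M`. Since `Γ = ⟨A⟩⟨X⟩`, the product action is simply transitive on vertices, so its orbit map
identifies the Cayley graph of `Γ` with the product of the two trees (`Realization.cayleyIso`).

*The finite residual of the double.* Comparing universal properties, one sees that `Λ` is the
amalgamated product of two copies of `Γ` over `⟨X⟩`. Suppose that no two letters `a ≠ b` are as
claimed. Then `Γ` has a finite index normal subgroup `N` such that `a⁻¹ b ∉ ⟨X⟩ N` for all letters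
`a ≠ b`: if `a⁻¹ b = h n` with `h` in `⟨X⟩`, then in `Λ` the element
`(a⁻¹ b) (ā⁻¹ b̄)⁻¹ = h n n̄⁻¹ h⁻¹` lies in every normal subgroup containing `n` and `n̄`. For such
an `N`, an element of `N` fixing a vertex of the first tree fixes all its neighbours, and hence the
whole tree (`Realization.left_eq_one_of_separates`). So `N ∩ ⟨X⟩` is normal in `Γ`, and the
conjugation action of `⟨A⟩` on it is the action on the vertices of the second tree, in which `⟨A⟩`
fixes the base vertex and therefore has finite orbits. As `N ∩ ⟨X⟩` is finitely generated,
a finite index subgroup of `⟨A⟩` centralizes it. Passing to words of even length, which form free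
groups, one finds that `Γ` is reducible (`Realization.isReducible_of_separates`), a contradiction.

*Irreducibility.* The element found above is non-trivial, because `a b⁻¹` is not in `⟨X⟩` when
`a ≠ b` and the two factors of the amalgamated product intersect in `⟨X⟩` only. So `Λ` is not
residually finite, whereas reducible groups are, since free groups are residually finite
(`IsReducible.residuallyFinite`).
-/

namespace BMW

/-! ### Groups generated by an alphabet with a formal inverse -/

section WordGroup

variable (L : Type*) [InvolutiveInv L]

/-- The group generated by an alphabet `L` that carries an involution `l ↦ l⁻¹`, subject only to
the relations saying that this involution is inversion. It is the free product of a copy of `ℤ`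
for each two-element orbit `{l, l⁻¹}` and a copy of `ℤ/2` for each letter with `l⁻¹ = l`. -/
abbrev WordGroup : Type _ :=
  PresentedGroup (Set.range fun l : L => FreeGroup.of l * FreeGroup.of l⁻¹)

variable {L}

namespace WordGroup

/-- A letter, as an element of the group. -/
def gen (l : L) : WordGroup L := PresentedGroup.of l

theorem gen_mul_gen_inv (l : L) : gen l * gen l⁻¹ = 1 :=
  PresentedGroup.one_of_mem ⟨l, rfl⟩

@[simp]
theorem gen_inv (l : L) : gen l⁻¹ = (gen l)⁻¹ :=
  eq_inv_of_mul_eq_one_right (gen_mul_gen_inv l)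

variable {H : Type*} [Group H]

/-- The universal property of `WordGroup L`. -/
def lift (f : L → H) (hf : ∀ l, f l⁻¹ = (f l)⁻¹) : WordGroup L →* H :=
  PresentedGroup.toGroup (f := f) (by rintro _ ⟨l, rfl⟩; simp [hf])

@[simp]
theorem lift_gen (f : L → H) (hf : ∀ l, f l⁻¹ = (f l)⁻¹) (l : L) : lift f hf (gen l) = f l :=
  PresentedGroup.toGroup.of _

theorem closure_range_gen : Subgroup.closure (Set.range (gen : L → WordGroup L)) = ⊤ :=
  PresentedGroup.closure_range_of _

theorem induction_left {p : WordGroup L → Prop} (one : p 1)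
    (mul : ∀ l w, p w → p (gen l * w)) (w : WordGroup L) : p w := by
  have hw : w ∈ Subgroup.closure (Set.range (gen : L → WordGroup L)) := by
    rw [closure_range_gen]; trivial
  induction hw using Subgroup.closure_induction_left with
  | one => exact one
  | mul_left x hx y _ hy => obtain ⟨l, rfl⟩ := hx; exact mul l y hy
  | inv_mul_cancel x hx y _ hy => obtain ⟨l, rfl⟩ := hx; rw [← gen_inv]; exact mul _ y hy

theorem induction_right {p : WordGroup L → Prop} (one : p 1)
    (mul : ∀ w l, p w → p (w * gen l)) (w : WordGroup L) : p w := by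
  rw [← inv_inv w]
  refine induction_left (p := fun w => p w⁻¹) (by simpa using one) (fun l w hw => ?_) w⁻¹
  rw [mul_inv_rev, ← gen_inv]
  exact mul _ _ hw

/-! ### Reduced words -/

/-- A word is reduced if no letter is followed by its inverse. -/
def Reduced (w : List L) : Prop := w.IsChain fun l l' => l' ≠ l⁻¹

open Classical in
/-- Put the letter `l` in front of a word, and cancel if possible. -/
noncomputable def push (l : L) : List L → List L
  | [] => [l]
  | l' :: w => if l' = l⁻¹ then w else l :: l' :: w

theorem Reduced.push {w : List L} (hw : Reduced w) (l : L) : Reduced (push l w) := by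
  cases w with
  | nil => simp [WordGroup.push, Reduced]
  | cons l' w =>
    simp only [WordGroup.push]
    split_ifs with h
    · exact List.IsChain.tail hw
    · exact List.IsChain.cons_cons h hw

theorem push_inv_push {w : List L} (hw : Reduced w) (l : L) : push l⁻¹ (push l w) = w := by
  rcases w with _ | ⟨l', w⟩
  · simp [push]
  · by_cases h : l' = l⁻¹
    · rcases w with _ | ⟨l'', w⟩
      · simp [push, h]
      · have : l'' ≠ l'⁻¹ := (List.isChain_cons_cons.1 hw).1
        subst h
        simp only [push, if_true]
        rw [if_neg this]
    · simp [push, h]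

/-- The action of a letter on the set of reduced words. -/
noncomputable def pushPerm (l : L) : Equiv.Perm {w : List L // Reduced w} where
  toFun w := ⟨push l w.1, w.2.push l⟩
  invFun w := ⟨push l⁻¹ w.1, w.2.push l⁻¹⟩
  left_inv w := Subtype.ext (push_inv_push w.2 l)
  right_inv w := Subtype.ext (by simpa using push_inv_push w.2 l⁻¹)

/-- The reduced word representing an element, found by letting the group act on reduced words
(van der Waerden's method). -/
noncomputable def normalForm (g : WordGroup L) : List L :=
  (lift pushPerm (fun l => by ext w; simp [pushPerm]) g ⟨[], List.isChain_nil⟩).1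

@[simp]
theorem normalForm_one : normalForm (1 : WordGroup L) = [] := by simp [normalForm]

theorem normalForm_gen_mul (l : L) (g : WordGroup L) :
    normalForm (gen l * g) = push l (normalForm g) := by
  simp [normalForm, pushPerm]

theorem normalForm_prod {w : List L} (hw : Reduced w) : normalForm (w.map gen).prod = w := by
  induction w with
  | nil => simp
  | cons l w ih =>
    rw [List.map_cons, List.prod_cons, normalForm_gen_mul, ih (List.IsChain.tail hw)]
    cases w with
    | nil => rfl
    | cons l' w => exact if_neg (List.isChain_cons_cons.1 hw).1

theorem gen_injective : Function.Injective (gen : L → WordGroup L) := by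
  intro l l' h
  have := congrArg normalForm h
  rw [← mul_one (gen l), ← mul_one (gen l'), normalForm_gen_mul, normalForm_gen_mul] at this
  simpa [push] using this

theorem gen_ne_one (l : L) : gen l ≠ 1 := by
  intro h
  have := congrArg normalForm h
  rw [← mul_one (gen l), normalForm_gen_mul] at this
  simp [push] at this

end WordGroup

/-! ### The Cayley graph is a tree -/

/-- A graph with a height function for which every edge joins different heights and every vertex
has at most one lower neighbour contains no cycle: consider a highest vertex of a cycle. -/
theorem isAcyclic_of_height {V : Type*} {G : SimpleGraph V} (h : V → ℕ)
    (hne : ∀ u v, G.Adj u v → h u ≠ h v)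
    (huniq : ∀ u v w, G.Adj u v → G.Adj u w → h v < h u → h w < h u → v = w) : G.IsAcyclic := by
  classical
  intro u c hc
  obtain ⟨v, hv, hmax⟩ := c.support.toFinset.exists_max_image h ⟨u, by simp⟩
  rw [List.mem_toFinset] at hv
  have hc' := hc.rotate hv
  have hle : ∀ w ∈ (c.rotate v hv).support, h w ≤ h v := by
    intro w hw
    apply hmax
    rw [List.mem_toFinset]
    rwa [SimpleGraph.Walk.mem_support_rotate_iff] at hw
  have h1 := SimpleGraph.Walk.adj_snd hc'.not_nil
  have h2 := (SimpleGraph.Walk.adj_penultimate hc'.not_nil).symm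
  refine hc'.snd_ne_penultimate (huniq v _ _ h1 h2 ?_ ?_)
  · exact lt_of_le_of_ne (hle _ (SimpleGraph.Walk.getVert_mem_support _ _)) (hne _ _ h1).symm
  · exact lt_of_le_of_ne (hle _ (SimpleGraph.Walk.getVert_mem_support _ _)) (hne _ _ h2).symm

namespace WordGroup

variable (L) in
/-- The Cayley graph of `WordGroup L` with respect to the letters. -/
abbrev tree : SimpleGraph (WordGroup L) := SimpleGraph.mulCayley (Set.range gen)

theorem tree_adj {u v : WordGroup L} : (tree L).Adj u v ↔ ∃ l : L, v = u * gen l := by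
  rw [SimpleGraph.mulCayley_adj']
  constructor
  · rintro ⟨-, _, ⟨l, rfl⟩, h | h⟩
    · exact ⟨l, h.symm⟩
    · exact ⟨l⁻¹, by simp [h]⟩
  · rintro ⟨l, rfl⟩
    exact ⟨by simpa using gen_ne_one l, _, ⟨l, rfl⟩, Or.inl rfl⟩

theorem tree_isTree : (tree L).IsTree where
  connected := by
    have key : ∀ w, (tree L).Reachable 1 w := fun w => by
      induction w using induction_right with
      | one => exact SimpleGraph.Reachable.refl _
      | mul w l h => exact h.trans (SimpleGraph.Adj.reachable (tree_adj.2 ⟨l, rfl⟩))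
    exact ⟨fun u v => (key u).symm.trans (key v)⟩
  isAcyclic := by
    -- edges multiply by a letter on the right, so the inverse is used to push a letter on the left
    refine isAcyclic_of_height (fun u => (normalForm u⁻¹).length) ?_ ?_
    · intro u v huv
      obtain ⟨l, rfl⟩ := tree_adj.1 huv
      simp only [mul_inv_rev, ← gen_inv, normalForm_gen_mul]
      cases normalForm u⁻¹ with
      | nil => simp [push]
      | cons l' w => simp only [push]; split_ifs <;> simp
    · intro u v w hv hw
      obtain ⟨l, rfl⟩ := tree_adj.1 hv
      obtain ⟨k, rfl⟩ := tree_adj.1 hw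
      simp only [mul_inv_rev, ← gen_inv, normalForm_gen_mul]
      cases normalForm u⁻¹ with
      | nil => simp [push]
      | cons l' w =>
        simp only [push, inv_inv]
        split_ifs with h1 h2 <;> simp_all

theorem encard_neighborSet_tree (u : WordGroup L) :
    ((tree L).neighborSet u).encard = ENat.card L := by
  have : (tree L).neighborSet u = Set.range fun l : L => u * gen l := by
    ext v
    rw [SimpleGraph.mem_neighborSet, tree_adj]
    simp [eq_comm]
  rw [this, ← Set.image_univ, Function.Injective.encard_image, Set.encard_univ]
  exact fun l k h => gen_injective (mul_left_cancel h)

/-! ### The subgroup of words of even length is free -/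

/-- The parity of the length of a word, as a permutation of the two residue classes. -/
def parity : WordGroup L →* Equiv.Perm Bool :=
  lift (fun _ => Equiv.boolNot) fun _ => by
    rw [eq_inv_iff_mul_eq_one]
    ext b
    simp

theorem parity_gen (l : L) : parity (gen l) = Equiv.boolNot := lift_gen _ _ l

/-- Write `e` and `e'` for the basis elements of the free group on `L` that belong to the letters `l`
and `l⁻¹`. The permutation of two copies of the free group that interchanges the copies, with
left multiplication by `e` in one direction and by `e'⁻¹` in the other. Replacing `l` by `l⁻¹`
inverts it. -/
def wreathPerm (l : L) : Equiv.Perm (FreeGroup L × Bool) where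
  toFun p := (bif p.2 then FreeGroup.of l * p.1 else (FreeGroup.of l⁻¹)⁻¹ * p.1, !p.2)
  invFun p := (bif p.2 then FreeGroup.of l⁻¹ * p.1 else (FreeGroup.of l)⁻¹ * p.1, !p.2)
  left_inv := by rintro ⟨w, _ | _⟩ <;> simp
  right_inv := by rintro ⟨w, _ | _⟩ <;> simp

/-- The permutation action generated by `wreathPerm`. -/
def wreath : WordGroup L →* Equiv.Perm (FreeGroup L × Bool) :=
  lift wreathPerm fun l => by ext p : 1; simp [wreathPerm, Equiv.Perm.inv_def, Equiv.symm]

theorem wreath_gen (l : L) : wreath (gen l) = wreathPerm l := lift_gen _ _ l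

theorem wreath_snd (g : WordGroup L) (p : FreeGroup L × Bool) :
    (wreath g p).2 = parity g p.2 := by
  induction g using induction_left generalizing p with
  | one => simp
  | mul l g ih =>
    rw [map_mul, map_mul, Equiv.Perm.mul_apply, Equiv.Perm.mul_apply, ← ih, wreath_gen, parity_gen]
    rfl

theorem wreath_mul_right (g : WordGroup L) (w v : FreeGroup L) (b : Bool) :
    (wreath g (w * v, b)).1 = (wreath g (w, b)).1 * v := by
  induction g using induction_left with
  | one => simp
  | mul l g ih =>
    have h := wreath_snd g (w * v, b)
    rw [← wreath_snd g (w, b)] at h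
    rw [map_mul, Equiv.Perm.mul_apply, Equiv.Perm.mul_apply]
    simp only [wreath_gen, wreathPerm, Equiv.coe_fn_mk]
    rw [ih, h]
    cases (wreath g (w, b)).2 <;> simp [mul_assoc]

/-- The embedding of the group of words of even length into the free group on `L`: it sends
`l₁ l₂` to `e₁ e₂⁻¹`, where `e₁` is the basis element of the letter `l₁` and `e₂` that of `l₂⁻¹`. -/
def evenHom : (parity (L := L)).ker →* FreeGroup L where
  toFun g := (wreath g.1 (1, false)).1
  map_one' := by simp
  map_mul' g h := by
    rw [← wreath_mul_right, one_mul, Subgroup.coe_mul, map_mul, Equiv.Perm.mul_apply]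
    congr 2
    ext1
    · rfl
    · rw [wreath_snd, h.2]; rfl

/-- A word of even length is recovered from its image in the free group by substituting `l l₀⁻¹` for
the basis elements; for words of odd length there is an additional factor `l₀`. -/
theorem eq_lift_wreath (l₀ : L) (g : WordGroup L) :
    FreeGroup.lift (fun l => gen l * (gen l₀)⁻¹) (wreath g (1, false)).1 =
      (bif (wreath g (1, false)).2 then gen l₀ else 1) * g := by
  induction g using induction_left with
  | one => simp
  | mul l g ih =>
    rw [map_mul, Equiv.Perm.mul_apply]
    simp only [wreath_gen, wreathPerm, Equiv.coe_fn_mk]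
    cases h : (wreath g (1, false)).2 <;> simp [h] at ih ⊢ <;> simp [ih, mul_assoc]

theorem evenHom_injective [Nonempty L] : Function.Injective (evenHom (L := L)) := by
  obtain ⟨l₀⟩ := ‹Nonempty L›
  have key : ∀ g : (parity (L := L)).ker,
      FreeGroup.lift (fun l => gen l * (gen l₀)⁻¹) (evenHom g) = g.1 := by
    intro g
    have h := eq_lift_wreath l₀ g.1
    rw [wreath_snd, show parity g.1 = 1 from g.2] at h
    rw [Equiv.Perm.one_apply, cond_false, one_mul] at h
    exact h
  intro g h hgh
  exact Subtype.ext (by rw [← key g, ← key h, hgh])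

instance : (parity (L := L)).ker.FiniteIndex := Subgroup.finiteIndex_ker _

/-- A group of words of even length is free, by the Nielsen–Schreier theorem. -/
theorem isFreeGroup_of_le_ker_parity [Nonempty L] {H : Subgroup (WordGroup L)}
    (hH : H ≤ (parity (L := L)).ker) : IsFreeGroup H := by
  have hinj : Function.Injective (evenHom.comp (Subgroup.inclusion hH)) :=
    evenHom_injective.comp (Subgroup.inclusion_injective hH)
  exact IsFreeGroup.ofMulEquiv (MonoidHom.ofInjective hinj).symm

/-- If there are two letters, then every finite index subgroup is non-trivial: a product
`l k⁻¹` with `k ≠ l` has infinite order. -/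
theorem exists_mem_ne_one [Nontrivial L] (H : Subgroup (WordGroup L)) [H.FiniteIndex] :
    ∃ g ∈ H, g ≠ 1 := by
  obtain ⟨l, k, hlk⟩ := exists_pair_ne L
  let g : (parity (L := L)).ker := ⟨gen l * gen k⁻¹, by
    
    rw [MonoidHom.mem_ker, map_mul, parity_gen, parity_gen]
    ext b
    simp⟩
  have hg : evenHom g = FreeGroup.of l * (FreeGroup.of k)⁻¹ := by
    change (wreath (gen l * gen k⁻¹) (1, false)).1 = _
    rw [map_mul, Equiv.Perm.mul_apply, wreath_gen, wreath_gen]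
    simp [wreathPerm]
  have hg1 : evenHom g ≠ 1 := by
    rw [hg, Ne, mul_inv_eq_one]
    exact fun h => hlk (FreeGroup.of_injective h)
  obtain ⟨n, hn, -, hmem⟩ := H.exists_pow_mem_of_index_ne_zero Subgroup.FiniteIndex.index_ne_zero
    (g : WordGroup L)
  refine ⟨_, hmem, fun h => hg1 ?_⟩
  have h' : g ^ n = 1 := Subtype.ext (by simpa using h)
  have := congrArg evenHom h'
  rw [map_pow, map_one] at this
  exact (pow_eq_one_iff_left hn.ne').1 this

end WordGroup
end WordGroup

/-! ### Residual finiteness -/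

/-- A partial injection of a finite set extends to a permutation. -/
theorem exists_perm_of_rel {α : Type*} [Finite α] (r : α → α → Prop)
    (hr : ∀ i j j', r i j → r i j' → j = j') (hr' : ∀ i i' j, r i j → r i' j → i = i') :
    ∃ σ : Equiv.Perm α, ∀ i j, r i j → σ i = j := by
  classical
  have := Fintype.ofFinite α
  let e : {i // ∃ j, r i j} ≃ {j // ∃ i, r i j} :=
    { toFun := fun i => ⟨i.2.choose, i.1, i.2.choose_spec⟩
      invFun := fun j => ⟨j.2.choose, j.1, j.2.choose_spec⟩
      left_inv := fun i => Subtype.ext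
        (hr' _ _ _ (Exists.choose_spec (p := fun k => r k _) _) i.2.choose_spec)
      right_inv := fun j => Subtype.ext
        (hr _ _ _ (Exists.choose_spec (p := fun k => r _ k) _) j.2.choose_spec) }
  refine ⟨e.extendSubtype, fun i j hij => ?_⟩
  rw [e.extendSubtype_apply_of_mem i ⟨j, hij⟩]
  exact hr i _ _ (Exists.choose_spec (p := fun k => r i k) ⟨j, hij⟩) hij

/-- Free groups are residually finite: the letters of a reduced word of length `n` prescribe
partial injections of `{0, …, n}` under which the word moves `n` to `0`. -/
theorem residuallyFinite_freeGroup (α : Type*) : Group.ResiduallyFinite (FreeGroup α) := by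
  classical
  rw [Group.residuallyFinite_iff_exists_finiteIndex]
  intro g hg
  obtain ⟨w, hw, rfl⟩ : ∃ w : List (α × Bool), FreeGroup.IsReduced w ∧ FreeGroup.mk w = g :=
    ⟨g.toWord, FreeGroup.isReduced_toWord, FreeGroup.mk_toWord⟩
  have hw0 : 0 < w.length := by
    rcases w with _ | _
    · exact absurd rfl hg
    · simp
  -- consecutive letters are not inverse to each other
  have hred : ∀ (i : ℕ) (s : α) (b c : Bool), w[i]? = some (s, b) → w[i + 1]? = some (s, c) →
      b = c := by
    intro i s b c h1 h2
    obtain ⟨hi, h1⟩ := List.getElem?_eq_some_iff.1 h1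
    obtain ⟨hi', h2⟩ := List.getElem?_eq_some_iff.1 h2
    have := (List.isChain_iff_getElem.1 hw) i hi'
    rw [h1, h2] at this
    exact this rfl
  -- the letter at position `i` moves `i + 1` to `i`
  let r : α → Fin (w.length + 1) → Fin (w.length + 1) → Prop := fun s i j =>
    (i.1 = j.1 + 1 ∧ w[j.1]? = some (s, true)) ∨ (j.1 = i.1 + 1 ∧ w[i.1]? = some (s, false))
  have hσ : ∀ s, ∃ σ : Equiv.Perm (Fin (w.length + 1)), ∀ i j, r s i j → σ i = j := by
    intro s
    refine exists_perm_of_rel _ ?_ ?_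
    · rintro i j j' (⟨h1, h2⟩ | ⟨h1, h2⟩) (⟨h3, h4⟩ | ⟨h3, h4⟩)
      · exact Fin.ext (by omega)
      · rw [h1] at h4; cases hred _ _ _ _ h2 h4
      · rw [h3] at h2; cases hred _ _ _ _ h4 h2
      · exact Fin.ext (by omega)
    · rintro i i' j (⟨h1, h2⟩ | ⟨h1, h2⟩) (⟨h3, h4⟩ | ⟨h3, h4⟩)
      · exact Fin.ext (by omega)
      · rw [h3] at h2; cases hred _ _ _ _ h4 h2
      · rw [h1] at h4; cases hred _ _ _ _ h2 h4
      · exact Fin.ext (by omega)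
  choose σ hσ using hσ
  let f : FreeGroup α →* Equiv.Perm (Fin (w.length + 1)) := FreeGroup.lift σ
  have key : ∀ (k i : ℕ) (hk : k + i = w.length),
      f (FreeGroup.mk (w.drop i)) (Fin.last _) = ⟨i, by omega⟩ := by
    intro k
    induction k with
    | zero =>
      intro i hk
      rw [List.drop_of_length_le (by omega), ← FreeGroup.one_eq_mk, map_one]
      exact Fin.ext (by simp; omega)
    | succ k ih =>
      intro i hk
      have hi : i < w.length := by omega
      have hget := List.getElem?_eq_getElem hi
      rw [List.drop_eq_getElem_cons hi]
      generalize w[i] = a at hget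
      obtain ⟨s, b⟩ := a
      rw [← List.singleton_append, ← FreeGroup.mul_mk, map_mul, Equiv.Perm.mul_apply,
        ih (i + 1) (by omega)]
      cases b with
      | true =>
        have : f (FreeGroup.mk [(s, true)]) = σ s := FreeGroup.lift_apply_of
        rw [this]
        exact hσ s _ _ (Or.inl ⟨rfl, hget⟩)
      | false =>
        have : f (FreeGroup.mk [(s, false)]) = (σ s)⁻¹ := by
          rw [← FreeGroup.lift_apply_of (f := σ), ← map_inv]; rfl
        rw [this, Equiv.Perm.inv_eq_iff_eq]
        exact (hσ s _ _ (Or.inr ⟨rfl, hget⟩)).symm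
  refine ⟨f.ker, Subgroup.finiteIndex_ker f, fun h => ?_⟩
  have h0 := key w.length 0 rfl
  rw [List.drop_zero, MonoidHom.mem_ker.1 h] at h0
  exact hw0.ne' (congrArg Fin.val h0)

theorem residuallyFinite_of_finiteIndex {G : Type*} [Group G] (H : Subgroup G) [H.FiniteIndex]
    [Group.ResiduallyFinite H] : Group.ResiduallyFinite G := by
  rw [Group.residuallyFinite_iff_exists_finiteIndex]
  intro g hg
  by_cases hgH : g ∈ H
  · obtain ⟨K, hK, hgK⟩ := (Group.residuallyFinite_iff_exists_finiteIndex (G := H)).1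
      inferInstance ⟨g, hgH⟩ (by simpa [Subtype.ext_iff] using hg)
    refine ⟨K.map H.subtype, ⟨?_⟩, fun h => hgK ?_⟩
    · rw [Subgroup.index_map_subtype]
      exact mul_ne_zero hK.index_ne_zero Subgroup.FiniteIndex.index_ne_zero
    · obtain ⟨k, hk, hkg⟩ := h
      rwa [show (⟨g, hgH⟩ : H) = k from Subtype.ext hkg.symm]
  · exact ⟨H, inferInstance, hgH⟩

theorem IsReducible.residuallyFinite {G : Type*} [Group G] (h : IsReducible G) :
    Group.ResiduallyFinite G := by
  obtain ⟨H, hH, S, T, -, -, ⟨e⟩⟩ := h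
  have := residuallyFinite_freeGroup S
  have := residuallyFinite_freeGroup T
  have : Group.ResiduallyFinite H := by
    rw [Group.residuallyFinite_iff_exists_finiteIndex]
    intro g hg
    obtain ⟨K, hK, hgK⟩ := (Group.residuallyFinite_iff_exists_finiteIndex).1
      (inferInstance : Group.ResiduallyFinite (FreeGroup S × FreeGroup T)) (e g) (by simpa using hg)
    refine ⟨K.comap e.toMonoidHom, ⟨?_⟩, hgK⟩
    rw [K.index_comap_of_surjective e.surjective]
    exact hK.index_ne_zero
  exact residuallyFinite_of_finiteIndex H

open WordGroup

/-! ### Squares and the actions on the two trees -/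

/-- The combinatorial data of a square complex with one vertex, whose oriented edges are labelled
by the letters in `L` and `M`: the square with corner `(x, a)` has the boundary
`x a = b y` with `b = act x a` and `y = res x a`. The axioms say that the same square has the
corners `y a⁻¹ = b⁻¹ x` and `x⁻¹ b = a y⁻¹`. -/
structure SquareData (L M : Type*) [InvolutiveInv L] [InvolutiveInv M] where
  /-- The letter `b` in `x a = b y`. -/
  act : M → L → L
  /-- The letter `y` in `x a = b y`. -/
  res : M → L → M
  act_res_inv : ∀ x a, act (res x a) a⁻¹ = (act x a)⁻¹
  res_res_inv : ∀ x a, res (res x a) a⁻¹ = x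
  act_inv_act : ∀ x a, act x⁻¹ (act x a) = a
  res_inv_act : ∀ x a, res x⁻¹ (act x a) = (res x a)⁻¹

namespace SquareData

variable {L M : Type*} [InvolutiveInv L] [InvolutiveInv M] (K : SquareData L M)

/-- The same squares with the roles of `L` and `M` exchanged: `x a = b y` is read as
`a⁻¹ x⁻¹ = y⁻¹ b⁻¹`. -/
@[simps]
def dual : SquareData M L where
  act a x := (K.res x⁻¹ a⁻¹)⁻¹
  res a x := (K.act x⁻¹ a⁻¹)⁻¹
  act_res_inv a x := by simpa using congrArg (·⁻¹) (K.res_inv_act x⁻¹ a⁻¹)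
  res_res_inv a x := by simpa using congrArg (·⁻¹) (K.act_inv_act x⁻¹ a⁻¹)
  act_inv_act a x := by simpa using congrArg (·⁻¹) (K.res_res_inv x⁻¹ a⁻¹)
  res_inv_act a x := by simpa using congrArg (·⁻¹) (K.act_res_inv x⁻¹ a⁻¹)

/-- Right multiplication by the letter `a⁻¹` on expressions `u x` with `u` a word in `L` and `x` a
letter in `M`: it takes `u x` to `(u b) y`, where `x a⁻¹ = b y`. -/
def transducerPerm (a : L) : Equiv.Perm (WordGroup L × M) where
  toFun p := (p.1 * gen (K.act p.2 a⁻¹), K.res p.2 a⁻¹)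
  invFun p := (p.1 * gen (K.act p.2 a), K.res p.2 a)
  left_inv p := by
    have h1 := K.act_res_inv p.2 a⁻¹
    have h2 := K.res_res_inv p.2 a⁻¹
    rw [inv_inv] at h1 h2
    simp [h1, h2]
  right_inv p := by simp [K.act_res_inv, K.res_res_inv]

/-- The action of `WordGroup L` on `WordGroup L × M` by right multiplication with the inverse. -/
def transducer : WordGroup L →* Equiv.Perm (WordGroup L × M) :=
  lift K.transducerPerm fun a => by
    ext p : 1; simp [transducerPerm, Equiv.Perm.inv_def, Equiv.symm]

theorem transducer_gen (a : L) : K.transducer (gen a) = K.transducerPerm a := lift_gen _ _ a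

theorem transducer_mul_left (v w u : WordGroup L) (x : M) :
    (K.transducer w (v * u, x)) =
      (v * (K.transducer w (u, x)).1, (K.transducer w (u, x)).2) := by
  induction w using induction_left with
  | one => simp
  | mul l w ih =>
    rw [map_mul, Equiv.Perm.mul_apply, Equiv.Perm.mul_apply, ih, transducer_gen]
    simp [transducerPerm, mul_assoc]

/-- The action of a letter `x` in `M` on `WordGroup L`: the element `u` for which `x w = u y` with
a letter `y`. -/
def slide (x : M) (w : WordGroup L) : WordGroup L := (K.transducer w⁻¹ (1, x)).1

@[simp]
theorem slide_one (x : M) : K.slide x 1 = 1 := by simp [slide]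

theorem slide_gen_mul (x : M) (a : L) (w : WordGroup L) :
    K.slide x (gen a * w) = gen (K.act x a) * K.slide (K.res x a) w := by
  have h : K.transducer (gen a)⁻¹ (1, x) = (gen (K.act x a) * 1, K.res x a) := by
    rw [← gen_inv, transducer_gen]
    simp [transducerPerm]
  rw [slide, mul_inv_rev, map_mul, Equiv.Perm.mul_apply, h, transducer_mul_left, slide]

theorem slide_inv_slide (x : M) (w : WordGroup L) : K.slide x⁻¹ (K.slide x w) = w := by
  induction w using induction_left generalizing x with
  | one => simp
  | mul a w ih => rw [slide_gen_mul, slide_gen_mul, act_inv_act, res_inv_act, ih]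

theorem slide_mul_gen (x : M) (w : WordGroup L) (a : L) :
    ∃ b, K.slide x (w * gen a) = K.slide x w * gen b := by
  induction w using induction_left generalizing x with
  | one => exact ⟨K.act x a, by simpa using K.slide_gen_mul x a 1⟩
  | mul l w ih =>
    obtain ⟨b, hb⟩ := ih (K.res x l)
    exact ⟨b, by rw [mul_assoc, slide_gen_mul, slide_gen_mul, hb, mul_assoc]⟩

/-- `slide x` as a permutation. -/
def slidePerm (x : M) : Equiv.Perm (WordGroup L) where
  toFun := K.slide x
  invFun := K.slide x⁻¹
  left_inv := K.slide_inv_slide x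
  right_inv w := by simpa using K.slide_inv_slide x⁻¹ w

theorem slidePerm_inv (x : M) : K.slidePerm x⁻¹ = (K.slidePerm x)⁻¹ := by
  ext w
  rfl

theorem slidePerm_mul_mulLeft (x : M) (a : L) :
    K.slidePerm x * Equiv.mulLeft (gen a) =
      Equiv.mulLeft (gen (K.act x a)) * K.slidePerm (K.res x a) := by
  ext w
  exact K.slide_gen_mul x a w

end SquareData

/-- A group generated by `L` and `M`, in which the squares `x a = b y` hold, and which acts on
`WordGroup L` and on `WordGroup M` in the way prescribed by the squares: the letters in `L` act on
`WordGroup L` by left multiplication and the letters in `M` by `slide`, and dually for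
`WordGroup M`. -/
structure Realization {L M : Type*} [InvolutiveInv L] [InvolutiveInv M] (K : SquareData L M)
    (G : Type*) [Group G] where
  /-- The letters in `L`. -/
  ofL : L → G
  /-- The letters in `M`. -/
  ofM : M → G
  ofL_inv : ∀ a, ofL a⁻¹ = (ofL a)⁻¹
  ofM_inv : ∀ x, ofM x⁻¹ = (ofM x)⁻¹
  comm : ∀ x a, ofM x * ofL a = ofL (K.act x a) * ofM (K.res x a)
  closure_eq_top : Subgroup.closure (Set.range ofL ∪ Set.range ofM) = ⊤
  /-- The action on `WordGroup L`. -/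
  left : G →* Equiv.Perm (WordGroup L)
  left_ofL : ∀ a, left (ofL a) = Equiv.mulLeft (gen a)
  left_ofM : ∀ x, left (ofM x) = K.slidePerm x
  /-- The action on `WordGroup M`. -/
  right : G →* Equiv.Perm (WordGroup M)
  right_ofL : ∀ a, right (ofL a) = K.dual.slidePerm a
  right_ofM : ∀ x, right (ofM x) = Equiv.mulLeft (gen x)

namespace Realization

variable {L M : Type*} [InvolutiveInv L] [InvolutiveInv M] {K : SquareData L M}
  {G : Type*} [Group G] (r : Realization K G)

/-- The roles of `L` and `M` can be exchanged. -/
def dual : Realization K.dual G where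
  ofL := r.ofM
  ofM := r.ofL
  ofL_inv := r.ofM_inv
  ofM_inv := r.ofL_inv
  comm a x := by
    have h := congrArg (·⁻¹) (r.comm x⁻¹ a⁻¹)
    simpa [r.ofL_inv, r.ofM_inv] using h
  closure_eq_top := by rw [Set.union_comm]; exact r.closure_eq_top
  left := r.right
  left_ofL := r.right_ofM
  left_ofM := r.right_ofL
  right := r.left
  right_ofL a := by
    rw [r.left_ofM]
    have : K.dual.dual = K := by cases K; simp [SquareData.dual]
    rw [this]
  right_ofM := r.left_ofL

/-- The homomorphism onto the subgroup generated by `L`. -/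
def homL : WordGroup L →* G := lift r.ofL r.ofL_inv

/-- The homomorphism onto the subgroup generated by `M`. -/
def homM : WordGroup M →* G := lift r.ofM r.ofM_inv

@[simp]
theorem homL_gen (a : L) : r.homL (gen a) = r.ofL a := lift_gen _ _ a

@[simp]
theorem homM_gen (x : M) : r.homM (gen x) = r.ofM x := lift_gen _ _ x

theorem left_homL (u v : WordGroup L) : r.left (r.homL u) v = u * v := by
  induction u using induction_left with
  | one => simp
  | mul a u ih => simp [r.left_ofL, ih, mul_assoc]

theorem left_homM_one (u : WordGroup M) : r.left (r.homM u) 1 = 1 := by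
  induction u using induction_left with
  | one => simp
  | mul x u ih =>
    rw [map_mul, map_mul, Equiv.Perm.mul_apply, ih, homM_gen, left_ofM]
    exact K.slide_one x

theorem right_homM (u v : WordGroup M) : r.right (r.homM u) v = u * v := r.dual.left_homL u v

theorem right_homL_one (u : WordGroup L) : r.right (r.homL u) 1 = 1 := r.dual.left_homM_one u

theorem closure_induction {p : G → Prop} (one : p 1) (ofL : ∀ a g, p g → p (r.ofL a * g))
    (ofM : ∀ x g, p g → p (r.ofM x * g)) (g : G) : p g := by
  have hg : g ∈ Subgroup.closure (Set.range r.ofL ∪ Set.range r.ofM) := by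
    rw [r.closure_eq_top]; trivial
  induction hg using Subgroup.closure_induction_left with
  | one => exact one
  | mul_left s hs g _ ih =>
    rcases hs with ⟨a, rfl⟩ | ⟨x, rfl⟩
    · exact ofL a g ih
    · exact ofM x g ih
  | inv_mul_cancel s hs g _ ih =>
    rcases hs with ⟨a, rfl⟩ | ⟨x, rfl⟩
    · rw [← r.ofL_inv]; exact ofL _ g ih
    · rw [← r.ofM_inv]; exact ofM _ g ih

theorem ofM_mul_homL (x : M) (u : WordGroup L) :
    ∃ y, r.ofM x * r.homL u = r.homL (K.slide x u) * r.ofM y := by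
  induction u using induction_left generalizing x with
  | one => exact ⟨x, by simp⟩
  | mul a u ih =>
    obtain ⟨y, hy⟩ := ih (K.res x a)
    refine ⟨y, ?_⟩
    rw [map_mul, homL_gen, ← mul_assoc, r.comm, mul_assoc, hy, K.slide_gen_mul, map_mul, homL_gen,
      mul_assoc]

theorem exists_eq_homL_mul_homM (g : G) : ∃ u v, g = r.homL u * r.homM v := by
  induction g using r.closure_induction with
  | one => exact ⟨1, 1, by simp⟩
  | ofL a g ih =>
    obtain ⟨u, v, rfl⟩ := ih
    exact ⟨gen a * u, v, by simp [mul_assoc]⟩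
  | ofM x g ih =>
    obtain ⟨u, v, rfl⟩ := ih
    obtain ⟨y, hy⟩ := r.ofM_mul_homL x u
    exact ⟨K.slide x u, gen y * v, by rw [← mul_assoc, hy]; simp [mul_assoc]⟩

/-- The stabilizer of the base vertex in the first tree is the subgroup generated by `M`. -/
theorem exists_eq_homM {g : G} (hg : r.left g 1 = 1) : ∃ v, g = r.homM v := by
  obtain ⟨u, v, rfl⟩ := r.exists_eq_homL_mul_homM g
  rw [map_mul, Equiv.Perm.mul_apply, left_homM_one, left_homL, mul_one] at hg
  exact ⟨v, by simp [hg]⟩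

theorem homM_injective : Function.Injective r.homM := by
  intro u v h
  simpa [right_homM] using congrArg (r.right · 1) h

theorem homL_injective : Function.Injective r.homL := r.dual.homM_injective

theorem ofL_injective : Function.Injective r.ofL := by
  intro a b h
  rw [← r.homL_gen, ← r.homL_gen] at h
  exact gen_injective (r.homL_injective h)

/-- The group acts simply transitively on the vertices of the product of the two trees. -/
theorem orbitMap_bijective : Function.Bijective fun g : G => (r.left g 1, r.right g 1) := by
  constructor
  · intro g h hgh
    obtain ⟨h1, h2⟩ := Prod.ext_iff.1 hgh
    simp only at h1 h2
    obtain ⟨v, hv⟩ := r.exists_eq_homM (g := g⁻¹ * h) (by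
      rw [map_mul, Equiv.Perm.mul_apply, ← h1, ← Equiv.Perm.mul_apply, ← map_mul]; simp)
    have hv1 : r.right (g⁻¹ * h) 1 = 1 := by
      rw [map_mul, Equiv.Perm.mul_apply, ← h2, ← Equiv.Perm.mul_apply, ← map_mul]; simp
    rw [hv, right_homM, mul_one] at hv1
    rw [hv1, map_one, inv_mul_eq_one] at hv
    exact hv
  · rintro ⟨u, v⟩
    refine ⟨r.homL u * r.homM ((r.right (r.homL u))⁻¹ v), ?_⟩
    ext1
    · simp only [map_mul, Equiv.Perm.mul_apply, left_homM_one, left_homL, mul_one]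
    · simp only [map_mul, Equiv.Perm.mul_apply, right_homM, mul_one]
      exact Equiv.apply_symm_apply _ _

theorem left_mul_gen (g : G) (u : WordGroup L) (a : L) :
    ∃ b, r.left g (u * gen a) = r.left g u * gen b := by
  induction g using r.closure_induction with
  | one => exact ⟨a, by simp⟩
  | ofL l g ih =>
    obtain ⟨b, hb⟩ := ih
    exact ⟨b, by rw [map_mul r.left, Equiv.Perm.mul_apply, Equiv.Perm.mul_apply, hb, r.left_ofL,
      Equiv.coe_mulLeft, mul_assoc]⟩
  | ofM x g ih =>
    obtain ⟨b, hb⟩ := ih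
    obtain ⟨c, hc⟩ := K.slide_mul_gen x (r.left g u) b
    refine ⟨c, ?_⟩
    rw [map_mul r.left, Equiv.Perm.mul_apply, Equiv.Perm.mul_apply, hb, r.left_ofM]
    exact hc

theorem right_mul_gen (g : G) (u : WordGroup M) (x : M) :
    ∃ y, r.right g (u * gen x) = r.right g u * gen y := r.dual.left_mul_gen g u x

/-- The action on the first tree by graph automorphisms. -/
def leftIso (g : G) : tree L ≃g tree L where
  toEquiv := r.left g
  map_rel_iff' := by
    have key : ∀ (g : G) (u v : WordGroup L), (tree L).Adj u v →
        (tree L).Adj (r.left g u) (r.left g v) := by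
      intro g u v h
      obtain ⟨a, rfl⟩ := tree_adj.1 h
      exact tree_adj.2 (r.left_mul_gen g u a)
    intro u v
    refine ⟨fun h => ?_, key g u v⟩
    simpa using key g⁻¹ _ _ h

/-- The action on the second tree by graph automorphisms. -/
def rightIso (g : G) : tree M ≃g tree M := r.dual.leftIso g

theorem left_mul_ofL_one (g : G) (u : WordGroup L) :
    (tree L).Adj (r.left g 1) u ↔ ∃ a, u = r.left (g * r.ofL a) 1 := by
  obtain ⟨v, rfl⟩ := (r.left g).surjective u
  rw [show (tree L).Adj (r.left g 1) (r.left g v) ↔ (tree L).Adj 1 v from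
    (r.leftIso g).map_rel_iff', tree_adj]
  simp [r.left_ofL]

theorem right_mul_ofM_one (g : G) (u : WordGroup M) :
    (tree M).Adj (r.right g 1) u ↔ ∃ x, u = r.right (g * r.ofM x) 1 := r.dual.left_mul_ofL_one g u

theorem left_mul_ofM (g : G) (x : M) : r.left (g * r.ofM x) 1 = r.left g 1 := by
  rw [map_mul, Equiv.Perm.mul_apply, ← homM_gen, left_homM_one]

theorem right_mul_ofL (g : G) (a : L) : r.right (g * r.ofL a) 1 = r.right g 1 :=
  r.dual.left_mul_ofM g a

/-- The orbit map of the base vertex is an isomorphism from the Cayley graph to the product of the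
two trees. -/
noncomputable def cayleyIso (S : Set G)
    (hS : ∀ g, (g ∈ S ∨ g⁻¹ ∈ S) ↔ g ∈ Set.range r.ofL ∪ Set.range r.ofM) :
    SimpleGraph.mulCayley S ≃g (tree L).boxProd (tree M) where
  toEquiv := Equiv.ofBijective _ r.orbitMap_bijective
  map_rel_iff' := by
    intro g h
    have h1 : (SimpleGraph.mulCayley S).Adj g h ↔
        g ≠ h ∧ g⁻¹ * h ∈ Set.range r.ofL ∪ Set.range r.ofM := by
      rw [← hS, SimpleGraph.mulCayley_adj']
      refine and_congr_right fun _ => ?_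
      constructor
      · rintro ⟨s, hs, rfl | rfl⟩
        · left; simpa
        · right; simpa
      · rintro (hs | hs)
        · exact ⟨_, hs, by simp⟩
        · exact ⟨_, hs, by simp⟩
    simp only [Equiv.ofBijective_apply, SimpleGraph.boxProd_adj]
    rw [left_mul_ofL_one, right_mul_ofM_one, h1]
    constructor
    · rintro (⟨⟨a, ha⟩, h2⟩ | ⟨⟨x, hx⟩, h2⟩)
      · have : h = g * r.ofL a := r.orbitMap_bijective.1 (Prod.ext ha (by
          simp only [right_mul_ofL, h2]))
        subst this
        refine ⟨fun h => ?_, by simp⟩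
        rw [left_eq_mul, ← homL_gen, ← map_one r.homL] at h
        exact gen_ne_one a (r.homL_injective h)
      · have : h = g * r.ofM x := r.orbitMap_bijective.1 (Prod.ext (by
          simp only [left_mul_ofM, h2]) hx)
        subst this
        refine ⟨fun h => ?_, by simp⟩
        rw [left_eq_mul, ← homM_gen, ← map_one r.homM] at h
        exact gen_ne_one x (r.homM_injective h)
    · rintro ⟨-, ⟨a, ha⟩ | ⟨x, hx⟩⟩
      · obtain rfl : h = g * r.ofL a := by rw [ha]; simp
        exact Or.inl ⟨⟨a, rfl⟩, (r.right_mul_ofL g a).symm⟩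
      · obtain rfl : h = g * r.ofM x := by rw [hx]; simp
        exact Or.inr ⟨⟨x, rfl⟩, (r.left_mul_ofM g x).symm⟩

theorem cayleyIso_mul (S : Set G)
    (hS : ∀ g, (g ∈ S ∨ g⁻¹ ∈ S) ↔ g ∈ Set.range r.ofL ∪ Set.range r.ofM) (g h : G) :
    r.cayleyIso S hS (g * h) =
      (r.leftIso g (r.cayleyIso S hS h).1, r.rightIso g (r.cayleyIso S hS h).2) := by
  change (r.left (g * h) 1, r.right (g * h) 1) = (r.left g (r.left h 1), r.right g (r.right h 1))
  simp

end Realization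

/-- The condition defining BMW-groups can be checked with trees whose vertex sets are small, but do
not necessarily lie in the lowest universe. -/
theorem isBMWGroup_of_iso {G : Type*} [Group G] {S : Set G} {k l : ℕ} (hfin : S.Finite)
    (hS : Subgroup.closure S = ⊤) {V W : Type*} [Small.{0} V] [Small.{0} W]
    {T : SimpleGraph V} {T' : SimpleGraph W} (hT : T.IsTree) (hT' : T'.IsTree)
    (hV : ∀ v, (T.neighborSet v).encard = k) (hW : ∀ w, (T'.neighborSet w).encard = l)
    (e : SimpleGraph.mulCayley S ≃g T.boxProd T')
    (φ : G → (T ≃g T)) (ψ : G → (T' ≃g T'))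
    (h : ∀ g h, e (g * h) = (φ g (e h).1, ψ g (e h).2)) : IsBMWGroup G S k l := by
  let α : T ≃g T.map (equivShrink.{0} V).toEmbedding := SimpleGraph.Iso.map _ T
  let β : T' ≃g T'.map (equivShrink.{0} W).toEmbedding := SimpleGraph.Iso.map _ T'
  refine ⟨hfin, hS, Shrink.{0} V, Shrink.{0} W, _, _, α.isTree_iff.1 hT, β.isTree_iff.1 hT',
    fun v => ?_, fun w => ?_, ?_⟩
  · rw [← hV (α.symm v), Set.encard, Set.encard]
    exact ENat.card_congr (α.symm.mapNeighborSet v)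
  · rw [← hW (β.symm w), Set.encard, Set.encard]
    exact ENat.card_congr (β.symm.mapNeighborSet w)
  · refine ⟨e.trans ⟨α.toEquiv.prodCongr β.toEquiv, ?_⟩, fun g =>
      ⟨α.symm.trans ((φ g).trans α), β.symm.trans ((ψ g).trans β), fun k => ?_⟩⟩
    · rintro ⟨u, v⟩ ⟨u', v'⟩
      simp only [SimpleGraph.boxProd_adj, Equiv.prodCongr_apply, Prod.map]
      rw [show ∀ a b, (T.map (equivShrink.{0} V).toEmbedding).Adj (α.toEquiv a) (α.toEquiv b) ↔
        T.Adj a b from fun a b => α.map_rel_iff', show ∀ a b,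
        (T'.map (equivShrink.{0} W).toEmbedding).Adj (β.toEquiv a) (β.toEquiv b) ↔
        T'.Adj a b from fun a b => β.map_rel_iff', α.toEquiv.injective.eq_iff,
        β.toEquiv.injective.eq_iff]
    · change (α (e (g * k)).1, β (e (g * k)).2) =
        (α (φ g (α.symm (α (e k).1))), β (ψ g (β.symm (β (e k).2))))
      rw [h, α.symm_apply_apply, β.symm_apply_apply]

instance (L : Type*) [InvolutiveInv L] [Finite L] : Countable (WordGroup L) :=
  (PresentedGroup.mk_surjective _).countable

theorem Realization.isBMWGroup {L M : Type*} [InvolutiveInv L] [InvolutiveInv M]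
    [Finite L] [Finite M] {K : SquareData L M} {G : Type*} [Group G] (r : Realization K G)
    (S : Set G) (hfin : S.Finite) (hS' : Subgroup.closure S = ⊤)
    (hS : ∀ g, (g ∈ S ∨ g⁻¹ ∈ S) ↔ g ∈ Set.range r.ofL ∪ Set.range r.ofM) :
    IsBMWGroup G S (Nat.card L) (Nat.card M) :=
  isBMWGroup_of_iso hfin hS' tree_isTree tree_isTree
    (fun v => by rw [encard_neighborSet_tree, ENat.card_eq_coe_natCard])
    (fun v => by rw [encard_neighborSet_tree, ENat.card_eq_coe_natCard])
    (r.cayleyIso S hS) r.leftIso r.rightIso (r.cayleyIso_mul S hS)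

/-! ### Finite index subgroups that separate the generators -/

theorem finiteIndex_comap {G H : Type*} [Group G] [Group H] (f : G →* H) (K : Subgroup H)
    [K.FiniteIndex] : (K.comap f).FiniteIndex :=
  ⟨by rw [K.index_comap]; exact Subgroup.isFiniteRelIndex_of_finiteIndex.relIndex_ne_zero⟩

/-- A subgroup finitely many two-sided translates of which cover the group has finite index: the
translate `a H b` is a left coset of a conjugate of `H`, so that B. H. Neumann's lemma applies. -/
theorem finiteIndex_of_forall_exists_mul {G : Type*} [Group G] {H : Subgroup G} {A B : Set G}
    (hA : A.Finite) (hB : B.Finite) (h : ∀ g, ∃ a ∈ A, ∃ b ∈ B, ∃ k ∈ H, g = a * k * b) :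
    H.FiniteIndex := by
  obtain ⟨⟨a, b⟩, -, hab⟩ := Subgroup.exists_finiteIndex_of_leftCoset_cover
    (ι := G × G) (H := fun p => H.map (MulAut.conj p.2⁻¹).toMonoidHom) (g := fun p => p.1 * p.2)
    (s := (hA.prod hB).toFinset) (by
      rw [Set.eq_univ_iff_forall]
      intro g
      obtain ⟨a, ha, b, hb, k, hk, rfl⟩ := h g
      rw [Set.mem_iUnion₂]
      refine ⟨(a, b), by simpa using ⟨ha, hb⟩, ?_⟩
      rw [Set.mem_smul_set]
      exact ⟨_, ⟨k, hk, rfl⟩, by simp [mul_assoc]⟩)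
  exact ⟨by rw [← Subgroup.index_map_equiv H (MulAut.conj b⁻¹)]; exact hab.index_ne_zero⟩

theorem finiteIndex_comap_stabilizer {H X : Type*} [Group H] (φ : H →* Equiv.Perm X) {F : Set X}
    (hF : F.Finite) (hφ : ∀ h, ∀ x ∈ F, φ h x ∈ F) {x : X} (hx : x ∈ F) :
    ((MulAction.stabilizer (Equiv.Perm X) x).comap φ).FiniteIndex := by
  let _ := MulAction.compHom X φ
  have hs : (MulAction.stabilizer (Equiv.Perm X) x).comap φ = MulAction.stabilizer H x := rfl
  have hfin : (MulAction.orbit H x).Finite := hF.subset (by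
    rintro _ ⟨h, rfl⟩
    exact hφ h x hx)
  rw [hs]
  constructor
  rw [MulAction.index_stabilizer]
  exact Set.ncard_ne_zero_of_mem (MulAction.mem_orbit_self x) hfin

instance (L : Type*) [InvolutiveInv L] [Finite L] : Group.FG (WordGroup L) :=
  Group.fg_iff.2 ⟨_, closure_range_gen, Set.finite_range _⟩

/-- A countable non-trivial free group is free on a non-empty set in the lowest universe. -/
theorem exists_mulEquiv_freeGroup (H : Type*) [Group H] [IsFreeGroup H] [Countable H]
    [Nontrivial H] : ∃ S : Type, Nonempty S ∧ Nonempty (H ≃* FreeGroup S) := by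
  let e := IsFreeGroup.toFreeGroup H
  have hinj : Function.Injective fun s : IsFreeGroup.Generators H => e.symm (FreeGroup.of s) :=
    e.symm.injective.comp FreeGroup.of_injective
  have : Countable (IsFreeGroup.Generators H) := hinj.countable
  refine ⟨Shrink.{0} (IsFreeGroup.Generators H), ?_,
    ⟨e.trans (FreeGroup.freeGroupCongr (equivShrink _))⟩⟩
  by_contra hne
  rw [← (equivShrink.{0} (IsFreeGroup.Generators H)).nonempty_congr, not_nonempty_iff] at hne
  exact not_subsingleton H e.toEquiv.subsingleton

namespace Realization

variable {L M : Type*} [InvolutiveInv L] [InvolutiveInv M] {K : SquareData L M}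
  {G : Type*} [Group G] (r : Realization K G)

/-- Each vertex of the second tree lies in a finite set (a ball around the base vertex) that is
invariant under the stabilizer of the base vertex. -/
theorem exists_finite_invariant [Finite M] (v : WordGroup M) :
    ∃ F : Set (WordGroup M), F.Finite ∧ v ∈ F ∧
      ∀ g, r.right g 1 = 1 → ∀ u ∈ F, r.right g u ∈ F := by
  induction v using induction_right with
  | one => exact ⟨{1}, Set.finite_singleton 1, rfl, by rintro g hg _ rfl; exact hg⟩
  | mul v x ih =>
    obtain ⟨F, hF, hv, hinv⟩ := ih
    refine ⟨Set.image2 (fun u y => u * gen y) F Set.univ, hF.image2 _ Set.finite_univ,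
      ⟨v, hv, x, trivial, rfl⟩, ?_⟩
    rintro g hg _ ⟨u, hu, y, -, rfl⟩
    obtain ⟨z, hz⟩ := r.right_mul_gen g u y
    exact ⟨_, hinv g hg u hu, z, trivial, hz.symm⟩

variable {r} {N : Subgroup G} [hnormal : N.Normal]

/-- If a normal subgroup `N` separates the generators modulo the subgroup generated by `M`, then
an element of `N` that fixes a vertex of the first tree fixes the adjacent vertices. -/
theorem left_mul_gen_of_separates
    (hN : ∀ a b, a ≠ b → ∀ v, ∀ n ∈ N, (r.ofL a)⁻¹ * r.ofL b ≠ r.homM v * n)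
    {n : G} (hn : n ∈ N) {v : WordGroup L} (hv : r.left n v = v) (a : L) :
    r.left n (v * gen a) = v * gen a := by
  obtain ⟨b, hb⟩ := r.left_mul_gen n v a
  rw [hv] at hb
  have h1 : r.left ((r.homL (v * gen b))⁻¹ * n * r.homL (v * gen a)) 1 = 1 := by
    rw [map_mul, map_mul, Equiv.Perm.mul_apply, Equiv.Perm.mul_apply, left_homL, mul_one, hb,
      ← map_inv r.homL, left_homL, inv_mul_cancel]
  obtain ⟨u, hu⟩ := r.exists_eq_homM h1
  by_cases hab : b = a
  · rw [hb, hab]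
  · refine absurd ?_ (hN b a hab u _ (hnormal.conj_mem _ (N.inv_mem hn) (r.homL (v * gen a))⁻¹))
    rw [← hu]
    simp [mul_assoc]

theorem left_eq_one_of_separates
    (hN : ∀ a b, a ≠ b → ∀ v, ∀ n ∈ N, (r.ofL a)⁻¹ * r.ofL b ≠ r.homM v * n)
    {n : G} (hn : n ∈ N) (hv : r.left n 1 = 1) : r.left n = 1 := by
  ext w
  induction w using induction_right with
  | one => exact hv
  | mul w a ih => exact left_mul_gen_of_separates hN hn ih a

/-- Conjugation by `L` on the kernel of the action on the first tree corresponds to the action on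
the second tree. -/
theorem commute_of_right_eq
    (hN : ∀ a b, a ≠ b → ∀ v, ∀ n ∈ N, (r.ofL a)⁻¹ * r.ofL b ≠ r.homM v * n)
    {v : WordGroup M} (hv : r.homM v ∈ N) {u : WordGroup L} (huv : r.right (r.homL u) v = v) :
    Commute (r.homL u) (r.homM v) := by
  have hone := left_eq_one_of_separates hN hv (r.left_homM_one v)
  have h1 : r.left (r.homL u * r.homM v * (r.homL u)⁻¹) 1 = 1 := by simp [hone]
  obtain ⟨w, hw⟩ := r.exists_eq_homM h1
  have h2 := congrArg (r.right · 1) hw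
  simp only [map_mul, Equiv.Perm.mul_apply, right_homM, mul_one, ← map_inv r.homL,
    right_homL_one, huv] at h2
  rw [← h2] at hw
  exact mul_inv_eq_iff_eq_mul.1 hw

/-- If a finite index normal subgroup `N` separates the generators modulo the subgroup generated by
`M`, then the group is virtually a product of two free groups: the elements of `N` generated by `M`
act trivially on the first tree, and a finite index subgroup of the group generated by `L`
centralizes them. -/
theorem isReducible_of_separates [Finite L] [Finite M] [Nontrivial L] [Nontrivial M]
    [N.FiniteIndex]
    (hN : ∀ a b, a ≠ b → ∀ v, ∀ n ∈ N, (r.ofL a)⁻¹ * r.ofL b ≠ r.homM v * n) :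
    IsReducible G := by
  have hD : (N.comap r.homM).FiniteIndex := finiteIndex_comap _ _
  obtain ⟨S, hS⟩ := (Group.fg_iff_subgroup_fg _).1 (N.comap r.homM).fg_of_index_ne_zero
  -- the elements of the group generated by `L` that commute with `N ∩ ⟨M⟩`
  let C : Subgroup (WordGroup L) :=
    ⨅ v ∈ S, (MulAction.stabilizer (Equiv.Perm (WordGroup M)) v).comap (r.right.comp r.homL)
  have hC : C.FiniteIndex := by
    refine Subgroup.finiteIndex_iInf' _ fun v _ => ?_
    obtain ⟨F, hF, hv, hinv⟩ := r.exists_finite_invariant v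
    exact finiteIndex_comap_stabilizer _ hF (fun u => hinv (r.homL u) (r.right_homL_one u)) hv
  have hcomm : ∀ u ∈ C, ∀ v ∈ N.comap r.homM, Commute (r.homL u) (r.homM v) := by
    intro u hu v hv
    have hle : N.comap r.homM ≤ (Subgroup.centralizer {r.homL u}).comap r.homM := by
      rw [← hS, Subgroup.closure_le]
      intro w hw
      refine Subgroup.mem_centralizer_singleton_iff.2
        (commute_of_right_eq hN (v := w) ?_ ?_).symm
      · have : w ∈ N.comap r.homM := hS ▸ Subgroup.subset_closure hw
        exact this
      · exact (Subgroup.mem_iInf.1 (Subgroup.mem_iInf.1 hu w) hw)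
    exact (Subgroup.mem_centralizer_singleton_iff.1 (hle hv)).symm
  let C' := C ⊓ (parity (L := L)).ker
  let D' := N.comap r.homM ⊓ (parity (L := M)).ker
  have : C'.FiniteIndex := inferInstanceAs (C ⊓ (parity (L := L)).ker).FiniteIndex
  have : D'.FiniteIndex := inferInstanceAs (N.comap r.homM ⊓ (parity (L := M)).ker).FiniteIndex
  let f : C' × D' →* G := (r.homL.comp C'.subtype).noncommCoprod (r.homM.comp D'.subtype)
    fun u v => hcomm u u.2.1 v v.2.1
  have hf : Function.Injective f := by
    rw [injective_iff_map_eq_one]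
    rintro ⟨u, v⟩ huv
    have huv : r.homL u * r.homM v = 1 := huv
    have h1 := congrArg (r.left · 1) huv
    have h2 := congrArg (r.right · 1) huv
    simp only [map_mul, Equiv.Perm.mul_apply, left_homM_one, left_homL, mul_one, map_one,
      Equiv.Perm.one_apply] at h1
    rw [h1, map_one, one_mul] at huv
    rw [← map_one r.homM] at huv
    exact Prod.ext (Subtype.ext h1) (Subtype.ext (r.homM_injective huv))
  have : IsFreeGroup C' := isFreeGroup_of_le_ker_parity inf_le_right
  have : IsFreeGroup D' := isFreeGroup_of_le_ker_parity inf_le_right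
  have : Nontrivial C' := (Subgroup.nontrivial_iff_exists_ne_one _).2 (exists_mem_ne_one C')
  have : Nontrivial D' := (Subgroup.nontrivial_iff_exists_ne_one _).2 (exists_mem_ne_one D')
  obtain ⟨S₁, hS₁, ⟨e₁⟩⟩ := exists_mulEquiv_freeGroup C'
  obtain ⟨S₂, hS₂, ⟨e₂⟩⟩ := exists_mulEquiv_freeGroup D'
  refine ⟨f.range, ?_, S₁, S₂, hS₁, hS₂,
    ⟨(MonoidHom.ofInjective hf).symm.trans (e₁.prodCongr e₂)⟩⟩
  refine finiteIndex_of_forall_exists_mul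
    (A := Set.range fun q : WordGroup L ⧸ C' => r.homL q.out)
    (B := Set.range fun q : WordGroup M ⧸ D' => (r.homM q.out)⁻¹)
    (Set.finite_range _) (Set.finite_range _) fun g => ?_
  obtain ⟨u, v, rfl⟩ := r.exists_eq_homL_mul_homM g
  obtain ⟨c, hc⟩ := QuotientGroup.mk_out_eq_mul C' u
  obtain ⟨d, hd⟩ := QuotientGroup.mk_out_eq_mul D' v⁻¹
  refine ⟨_, ⟨(u : WordGroup L ⧸ C'), rfl⟩, _, ⟨((v⁻¹ : WordGroup M) : WordGroup M ⧸ D'), rfl⟩,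
    _, ⟨(c⁻¹, d), rfl⟩, ?_⟩
  change _ = _ * (r.homL (c⁻¹ : C') * r.homM d) * _
  simp only [hc, hd]
  simp [mul_assoc]

end Realization

/-! ### The letters of a BMW-presentation -/

/-- Inversion on `{f i} ∪ {(f i)⁻¹}`. -/
instance signedSet.instInvolutiveInv {ι G : Type*} [Group G] (f : ι → G) :
    InvolutiveInv (signedSet f) where
  inv l := ⟨l.1⁻¹, by
    obtain ⟨i, hi | hi⟩ := l.2
    · exact ⟨i, Or.inr (by rw [hi])⟩
    · exact ⟨i, Or.inl (by rw [hi, inv_inv])⟩⟩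
  inv_inv l := Subtype.ext (inv_inv l.1)

@[simp]
theorem signedSet.coe_inv {ι G : Type*} [Group G] {f : ι → G} (l : signedSet f) :
    ((l⁻¹ : signedSet f) : G) = (l : G)⁻¹ := rfl

theorem mem_signedSet {ι G : Type*} [Group G] (f : ι → G) (i : ι) : f i ∈ signedSet f :=
  ⟨i, Or.inl rfl⟩

theorem map_mem_signedSet {ι κ G H : Type*} [Group G] [Group H] {f : ι → G} {f' : κ → H}
    (φ : G →* H) (s : ι → κ) (h : ∀ i, φ (f i) = f' (s i)) {g : G} (hg : g ∈ signedSet f) :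
    φ g ∈ signedSet f' := by
  obtain ⟨i, rfl | rfl⟩ := hg
  · exact ⟨s i, Or.inl (h i)⟩
  · exact ⟨s i, Or.inr (by rw [map_inv, h])⟩

instance signedSet.instFinite {ι G : Type*} [Group G] [Finite ι] (f : ι → G) :
    Finite (signedSet f) := by
  refine ((Set.finite_range f).union (Set.finite_range fun i => (f i)⁻¹)).subset ?_
  rintro g ⟨i, hi | hi⟩
  · exact Or.inl ⟨i, hi.symm⟩
  · exact Or.inr ⟨i, hi.symm⟩

/-- If the only coincidences in the family `f` and its inverses are `f i = (f i)⁻¹` for `i ∈ T`,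
then `{f i} ∪ {(f i)⁻¹}` has one element for each `i ∈ T` and two for each `i ∉ T`. -/
theorem card_signedSet {ι G : Type*} [Group G] [Finite ι] (f : ι → G) (T : Set ι)
    (h1 : ∀ i j, f i = f j → i = j) (h2 : ∀ i j, f i = (f j)⁻¹ → i = j)
    (h3 : ∀ i, f i = (f i)⁻¹ ↔ i ∈ T) :
    Nat.card (signedSet f) = 2 * {i | i ∉ T}.ncard + {i | i ∈ T}.ncard := by
  let F : ({i | i ∉ T} × Bool) ⊕ {i | i ∈ T} → signedSet f :=
    Sum.elim (fun p => bif p.2 then ⟨f p.1, mem_signedSet f _⟩ else ⟨f p.1, mem_signedSet f _⟩⁻¹)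
      fun i => ⟨f i, mem_signedSet f _⟩
  have hF : Function.Bijective F := by
    constructor
    · rintro (⟨⟨i, hi⟩, _ | _⟩ | ⟨i, hi⟩) (⟨⟨j, hj⟩, _ | _⟩ | ⟨j, hj⟩) h
      all_goals
        have h := congrArg Subtype.val h
        simp only [F, Sum.elim_inl, Sum.elim_inr, cond_true, cond_false, signedSet.coe_inv] at h
      · obtain rfl := h1 _ _ (inv_injective h); rfl
      · obtain rfl := h2 _ _ h.symm; exact absurd ((h3 _).1 h.symm) hi
      · obtain rfl := h2 _ _ h.symm; exact absurd hj hi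
      · obtain rfl := h2 _ _ h; exact absurd ((h3 _).1 h) hi
      · obtain rfl := h1 _ _ h; rfl
      · obtain rfl := h1 _ _ h; exact absurd hj hi
      · obtain rfl := h2 _ _ h; exact absurd hi hj
      · obtain rfl := h1 _ _ h; exact absurd hi hj
      · obtain rfl := h1 _ _ h; rfl
    · rintro ⟨g, i, rfl | rfl⟩
      · by_cases hi : i ∈ T
        · exact ⟨Sum.inr ⟨i, hi⟩, rfl⟩
        · exact ⟨Sum.inl (⟨i, hi⟩, true), rfl⟩
      · by_cases hi : i ∈ T
        · exact ⟨Sum.inr ⟨i, hi⟩, Subtype.ext ((h3 i).2 hi)⟩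
        · exact ⟨Sum.inl (⟨i, hi⟩, false), rfl⟩
  rw [← Nat.card_congr (Equiv.ofBijective F hF), Nat.card_sum, Nat.card_prod, Nat.card_coe_set_eq,
    Nat.card_coe_set_eq]
  simp [mul_comm]

section Letters

variable {A X : Type*} (R : Set (FreeGroup (A ⊕ X)))

/-- The set `A ∪ A⁻¹` in the group `⟨A ∪ X | R₂⟩`. -/
abbrev LetterA : Type _ :=
  signedSet (fun a : A => (PresentedGroup.of (Sum.inl a) : PresentedGroup (relatorsTwo R)))

/-- The set `X ∪ X⁻¹` in the group `⟨A ∪ X | R₂⟩`. -/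
abbrev LetterX : Type _ :=
  signedSet (fun x : X => (PresentedGroup.of (Sum.inr x) : PresentedGroup (relatorsTwo R)))

variable {R}

theorem of_sq_eq_one {t : A ⊕ X} (ht : FreeGroup.of t ^ 2 ∈ R) :
    (PresentedGroup.of t : PresentedGroup (relatorsTwo R)) ^ 2 = 1 :=
  PresentedGroup.one_of_mem (rels := relatorsTwo R) ⟨ht, t, rfl⟩

/-- The exponent sum of one generator `t`, modulo `2` if `t²` is a relator. -/
theorem exists_exponentSum (t : A ⊕ X) (k : ℕ) (hk : FreeGroup.of t ^ 2 ∈ R → (2 : ZMod k) = 0) :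
    ∃ φ : PresentedGroup (relatorsTwo R) →* Multiplicative (ZMod k),
      φ (PresentedGroup.of t) = Multiplicative.ofAdd 1 ∧
      ∀ s, s ≠ t → φ (PresentedGroup.of s) = 1 := by
  classical
  refine ⟨PresentedGroup.toGroup (f := fun s => if s = t then Multiplicative.ofAdd 1 else 1) ?_,
    ?_, fun s hs => ?_⟩
  · rintro r ⟨hr, s, rfl⟩
    rw [map_pow, FreeGroup.lift_apply_of]
    split_ifs with h
    · subst h
      rw [← ofAdd_nsmul, ← ofAdd_zero, ← hk hr]
      simp
    · exact one_pow 2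
  · rw [PresentedGroup.toGroup.of, if_pos rfl]
  · rw [PresentedGroup.toGroup.of, if_neg hs]

theorem eq_of_of_eq {s t : A ⊕ X}
    (h : (PresentedGroup.of s : PresentedGroup (relatorsTwo R)) = PresentedGroup.of t ∨
      (PresentedGroup.of s : PresentedGroup (relatorsTwo R)) = (PresentedGroup.of t)⁻¹) :
    s = t := by
  obtain ⟨φ, h1, h2⟩ := exists_exponentSum (R := R) t 2 (fun _ => rfl)
  by_contra hst
  rcases h with h | h
  · have := congrArg φ h
    rw [h2 s hst, h1] at this
    exact absurd this (by decide)
  · have := congrArg φ h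
    rw [h2 s hst, map_inv, h1] at this
    exact absurd this (by decide)

theorem of_eq_inv_iff (t : A ⊕ X) :
    (PresentedGroup.of t : PresentedGroup (relatorsTwo R)) = (PresentedGroup.of t)⁻¹ ↔
      FreeGroup.of t ^ 2 ∈ R := by
  constructor
  · intro h
    by_contra ht
    obtain ⟨φ, h1, -⟩ := exists_exponentSum (R := R) t 3 (fun h => absurd h ht)
    have := congrArg φ h
    rw [map_inv, h1] at this
    exact absurd this (by decide)
  · intro ht
    rw [eq_inv_iff_mul_eq_one, ← sq, of_sq_eq_one ht]

variable (R) in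
theorem card_letterA [Finite A] : Nat.card (LetterA R) = degreeA R :=
  card_signedSet _ {a | FreeGroup.of (Sum.inl a) ^ 2 ∈ R}
    (fun _ _ h => Sum.inl_injective (eq_of_of_eq (Or.inl h)))
    (fun _ _ h => Sum.inl_injective (eq_of_of_eq (Or.inr h))) fun _ => of_eq_inv_iff _

variable (R) in
theorem card_letterX [Finite X] : Nat.card (LetterX R) = degreeX R :=
  card_signedSet _ {x | FreeGroup.of (Sum.inr x) ^ 2 ∈ R}
    (fun _ _ h => Sum.inr_injective (eq_of_of_eq (Or.inl h)))
    (fun _ _ h => Sum.inr_injective (eq_of_of_eq (Or.inr h))) fun _ => of_eq_inv_iff _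

/-! ### The squares of a BMW-presentation -/

variable (R) in
/-- The word `a x a' x'` is, up to inversion and cyclic permutation, a relator in `R₄`. -/
def FormsSquare (a x a' x' : PresentedGroup (relatorsTwo R)) : Prop :=
  a * x * a' * x' ∈ relatorsFourImage R ∨ a' * x' * a * x ∈ relatorsFourImage R ∨
    a⁻¹ * x'⁻¹ * a'⁻¹ * x⁻¹ ∈ relatorsFourImage R ∨ a'⁻¹ * x⁻¹ * a⁻¹ * x'⁻¹ ∈ relatorsFourImage R

theorem FormsSquare.flipX {a x a' x' : PresentedGroup (relatorsTwo R)}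
    (h : FormsSquare R a x a' x') : FormsSquare R a⁻¹ x'⁻¹ a'⁻¹ x⁻¹ := by
  unfold FormsSquare at *
  simp only [inv_inv]
  tauto

theorem FormsSquare.flipA {a x a' x' : PresentedGroup (relatorsTwo R)}
    (h : FormsSquare R a x a' x') : FormsSquare R a'⁻¹ x⁻¹ a⁻¹ x'⁻¹ := by
  unfold FormsSquare at *
  simp only [inv_inv]
  tauto

theorem FormsSquare.map_eq_one {H : Type*} [Group H] {φ : PresentedGroup (relatorsTwo R) →* H}
    (hφ : ∀ g ∈ relatorsFourImage R, φ g = 1) {a x a' x' : PresentedGroup (relatorsTwo R)}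
    (h : FormsSquare R a x a' x') : φ a * φ x * φ a' * φ x' = 1 := by
  rcases h with h | h | h | h <;> have := hφ _ h <;> simp only [map_mul, map_inv] at this
  · exact this
  · have h' := congrArg (fun g => (φ a' * φ x')⁻¹ * g * (φ a' * φ x')) this
    simpa [mul_assoc] using h'
  · have h' := congrArg (fun g => φ a * g⁻¹ * (φ a)⁻¹) this
    simpa [mul_assoc] using h'
  · have h' := congrArg (fun g => (φ x')⁻¹ * g⁻¹ * φ x') this
    simpa [mul_assoc] using h'

theorem IsBMWPresentation.existsUnique_corner (hR : IsBMWPresentation R) (a : LetterA R)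
    (x : LetterX R) : ∃! p : LetterA R × LetterX R, FormsSquare R a x p.1 p.2 := by
  obtain ⟨p, ⟨h1, h2, h3⟩, huniq⟩ := hR.2 a a.2 x x.2
  refine ⟨(⟨p.1, h1⟩, ⟨p.2, h2⟩), h3, fun q hq => ?_⟩
  have := huniq (q.1, q.2) ⟨q.1.2, q.2.2, hq⟩
  exact Prod.ext (Subtype.ext (congrArg Prod.fst this)) (Subtype.ext (congrArg Prod.snd this))

/-- The pair `(a', x')` completing the corner `(a, x)` to a square. -/
noncomputable def IsBMWPresentation.corner (hR : IsBMWPresentation R) (a : LetterA R)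
    (x : LetterX R) : LetterA R × LetterX R := (hR.existsUnique_corner a x).choose

theorem IsBMWPresentation.formsSquare_corner (hR : IsBMWPresentation R) (a : LetterA R)
    (x : LetterX R) : FormsSquare R a x (hR.corner a x).1 (hR.corner a x).2 :=
  (hR.existsUnique_corner a x).choose_spec.1

theorem IsBMWPresentation.corner_eq (hR : IsBMWPresentation R) {a a' : LetterA R}
    {x x' : LetterX R} (h : FormsSquare R a x a' x') : hR.corner a x = (a', x') :=
  ((hR.existsUnique_corner a x).choose_spec.2 (a', x') h).symm

/-- The squares of a BMW-presentation: `x a = b y` holds if `a⁻¹ x⁻¹ b y` is a relator. -/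
noncomputable def IsBMWPresentation.squareData (hR : IsBMWPresentation R) :
    SquareData (LetterA R) (LetterX R) :=
  have h1 (x : LetterX R) (a : LetterA R) :
      hR.corner a⁻¹⁻¹ (hR.corner a⁻¹ x⁻¹).2⁻¹ = ((hR.corner a⁻¹ x⁻¹).1⁻¹, x) :=
    hR.corner_eq (by simpa using (hR.formsSquare_corner a⁻¹ x⁻¹).flipX)
  have h2 (x : LetterX R) (a : LetterA R) :
      hR.corner (hR.corner a⁻¹ x⁻¹).1⁻¹ x⁻¹⁻¹ = (a, (hR.corner a⁻¹ x⁻¹).2⁻¹) :=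
    hR.corner_eq (by simpa using (hR.formsSquare_corner a⁻¹ x⁻¹).flipA)
  { act := fun x a => (hR.corner a⁻¹ x⁻¹).1
    res := fun x a => (hR.corner a⁻¹ x⁻¹).2
    act_res_inv := fun x a => congrArg Prod.fst (h1 x a)
    res_res_inv := fun x a => congrArg Prod.snd (h1 x a)
    act_inv_act := fun x a => congrArg Prod.fst (h2 x a)
    res_inv_act := fun x a => congrArg Prod.snd (h2 x a) }

variable (R) in
/-- The quotient map `⟨A ∪ X | R₂⟩ → ⟨A ∪ X | R⟩`. -/
def quotientTwo : PresentedGroup (relatorsTwo R) →* PresentedGroup R :=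
  PresentedGroup.map (MonoidHom.id _) fun _ hr => hr.1

theorem quotientTwo_of (t : A ⊕ X) :
    quotientTwo R (PresentedGroup.of t) = PresentedGroup.of t := rfl

theorem quotientTwo_relatorsFourImage :
    ∀ g ∈ relatorsFourImage R, quotientTwo R g = 1 := by
  rintro _ ⟨r, hr, rfl⟩
  exact PresentedGroup.one_of_mem hr.1

/-- Homomorphisms out of `⟨A ∪ X | R⟩` can be prescribed on the letters, if they are compatible with
inversion and with the squares. -/
theorem IsBMWPresentation.exists_hom (hR : IsBMWPresentation R) {H : Type*} [Group H]
    (f : LetterA R → H) (g : LetterX R → H) (hf : ∀ a, f a⁻¹ = (f a)⁻¹)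
    (hg : ∀ x, g x⁻¹ = (g x)⁻¹)
    (hfg : ∀ x a, g x * f a = f (hR.squareData.act x a) * g (hR.squareData.res x a)) :
    ∃ φ : PresentedGroup R →* H, (∀ a : LetterA R, φ (quotientTwo R a) = f a) ∧
      ∀ x : LetterX R, φ (quotientTwo R x) = g x := by
  let F : FreeGroup (A ⊕ X) →* H := FreeGroup.lift (Sum.elim
    (fun a => f ⟨PresentedGroup.of (Sum.inl a), mem_signedSet _ a⟩)
    fun x => g ⟨PresentedGroup.of (Sum.inr x), mem_signedSet _ x⟩)
  have hFA : ∀ a ∈ signedSet (fun a : A => FreeGroup.of (Sum.inl a : A ⊕ X)),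
      ∃ l : LetterA R, PresentedGroup.mk _ a = l.1 ∧ F a = f l := by
    rintro _ ⟨a, rfl | rfl⟩
    · exact ⟨⟨PresentedGroup.of (Sum.inl a), mem_signedSet _ a⟩, rfl, FreeGroup.lift_apply_of⟩
    · refine ⟨⟨PresentedGroup.of (Sum.inl a), mem_signedSet _ a⟩⁻¹, rfl, ?_⟩
      rw [map_inv, hf]
      exact congrArg _ FreeGroup.lift_apply_of
  have hFX : ∀ x ∈ signedSet (fun x : X => FreeGroup.of (Sum.inr x : A ⊕ X)),
      ∃ l : LetterX R, PresentedGroup.mk _ x = l.1 ∧ F x = g l := by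
    rintro _ ⟨x, rfl | rfl⟩
    · exact ⟨⟨PresentedGroup.of (Sum.inr x), mem_signedSet _ x⟩, rfl, FreeGroup.lift_apply_of⟩
    · refine ⟨⟨PresentedGroup.of (Sum.inr x), mem_signedSet _ x⟩⁻¹, rfl, ?_⟩
      rw [map_inv, hg]
      exact congrArg _ FreeGroup.lift_apply_of
  have hF : ∀ r ∈ R, F r = 1 := by
    intro r hr
    rcases hR.1 r hr with ⟨hr, t, rfl⟩ | ⟨hr, a, ha, x, hx, a', ha', x', hx', rfl⟩
    · have ht : (PresentedGroup.of t : PresentedGroup (relatorsTwo R))⁻¹ = PresentedGroup.of t :=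
        ((of_eq_inv_iff t).2 hr).symm
      rw [map_pow, sq, ← eq_inv_iff_mul_eq_one]
      cases t with
      | inl a =>
        change F _ = (F _)⁻¹
        rw [show F (FreeGroup.of (Sum.inl a)) = f _ from FreeGroup.lift_apply_of, ← hf]
        exact congrArg f (Subtype.ext ht.symm)
      | inr x =>
        rw [show F (FreeGroup.of (Sum.inr x)) = g _ from FreeGroup.lift_apply_of, ← hg]
        exact congrArg g (Subtype.ext ht.symm)
    · obtain ⟨a, hma, hFa⟩ := hFA a ha
      obtain ⟨a', hma', hFa'⟩ := hFA a' ha'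
      obtain ⟨x, hmx, hFx⟩ := hFX x hx
      obtain ⟨x', hmx', hFx'⟩ := hFX x' hx'
      have hsq : FormsSquare R a x a' x' := by
        refine Or.inl ⟨_, ⟨hr, _, ha, _, hx, _, ha', _, hx', rfl⟩, ?_⟩
        rw [map_mul, map_mul, map_mul, hma, hmx, hma', hmx']
      have hc := hR.corner_eq hsq
      have := hfg x⁻¹ a⁻¹
      simp only [squareData, inv_inv, hc, hf, hg] at this
      rw [map_mul, map_mul, map_mul, hFa, hFx, hFa', hFx', mul_assoc, ← this]
      group
  refine ⟨PresentedGroup.toGroup hF, ?_, ?_⟩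
  · rintro ⟨_, a, rfl | rfl⟩
    · exact PresentedGroup.toGroup.of hF
    · rw [map_inv, map_inv, quotientTwo_of, PresentedGroup.toGroup.of hF]
      exact (hf ⟨PresentedGroup.of (Sum.inl a), mem_signedSet _ a⟩).symm
  · rintro ⟨_, x, rfl | rfl⟩
    · exact PresentedGroup.toGroup.of hF
    · rw [map_inv, map_inv, quotientTwo_of, PresentedGroup.toGroup.of hF]
      exact (hg ⟨PresentedGroup.of (Sum.inr x), mem_signedSet _ x⟩).symm

theorem mulLeft_inv {G : Type*} [Group G] (g : G) :
    Equiv.mulLeft g⁻¹ = (Equiv.mulLeft g)⁻¹ := by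
  ext
  rfl

/-- The group of a BMW-presentation acts on the two trees. -/
theorem IsBMWPresentation.exists_realization (hR : IsBMWPresentation R) :
    ∃ r : Realization hR.squareData (PresentedGroup R),
      (∀ a, r.ofL a = quotientTwo R a) ∧ ∀ x, r.ofM x = quotientTwo R x := by
  obtain ⟨φ, hφA, hφX⟩ := hR.exists_hom (fun a => Equiv.mulLeft (gen a)) hR.squareData.slidePerm
    (fun a => by rw [gen_inv, mulLeft_inv]) hR.squareData.slidePerm_inv
    hR.squareData.slidePerm_mul_mulLeft
  obtain ⟨ψ, hψA, hψX⟩ := hR.exists_hom hR.squareData.dual.slidePerm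
    (fun x => Equiv.mulLeft (gen x)) hR.squareData.dual.slidePerm_inv
    (fun a => by rw [gen_inv, mulLeft_inv]) (fun x a => by
      have := congrArg (·⁻¹) (hR.squareData.dual.slidePerm_mul_mulLeft a⁻¹ x⁻¹)
      simp only [SquareData.dual_act, SquareData.dual_res, inv_inv, mul_inv_rev, gen_inv,
        mulLeft_inv, SquareData.slidePerm_inv] at this
      exact this)
  refine ⟨{
    ofL := fun a => quotientTwo R a
    ofM := fun x => quotientTwo R x
    ofL_inv := fun a => by rw [signedSet.coe_inv, map_inv]
    ofM_inv := fun x => by rw [signedSet.coe_inv, map_inv]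
    comm := fun x a => ?_
    closure_eq_top := ?_
    left := φ
    left_ofL := hφA
    left_ofM := hφX
    right := ψ
    right_ofL := hψA
    right_ofM := hψX }, fun _ => rfl, fun _ => rfl⟩
  · have := (hR.formsSquare_corner a⁻¹ x⁻¹).map_eq_one quotientTwo_relatorsFourImage
    simp only [signedSet.coe_inv, map_inv] at this
    change _ = quotientTwo R (hR.corner a⁻¹ x⁻¹).1 * quotientTwo R (hR.corner a⁻¹ x⁻¹).2
    rw [mul_assoc, ← mul_inv_rev, inv_mul_eq_one] at this
    exact this
  · rw [eq_top_iff, ← PresentedGroup.closure_range_of, Subgroup.closure_le]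
    rintro _ ⟨a | x, rfl⟩
    · exact Subgroup.subset_closure (Or.inl ⟨⟨_, mem_signedSet _ a⟩, rfl⟩)
    · exact Subgroup.subset_closure (Or.inr ⟨⟨_, mem_signedSet _ x⟩, rfl⟩)

/-- The group of a BMW-presentation is a BMW-group of the same degree. -/
theorem IsBMWPresentation.isBMWGroup [Finite A] [Finite X] (hR : IsBMWPresentation R) :
    IsBMWGroup (PresentedGroup R) (Set.range PresentedGroup.of) (degreeA R) (degreeX R) := by
  obtain ⟨r, hA, hX⟩ := hR.exists_realization
  rw [← card_letterA, ← card_letterX]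
  refine r.isBMWGroup _ (Set.finite_range _) (PresentedGroup.closure_range_of R) fun g => ?_
  constructor
  · rintro (⟨a | x, rfl⟩ | ⟨a | x, h⟩)
    · exact Or.inl ⟨⟨_, mem_signedSet _ a⟩, hA _⟩
    · exact Or.inr ⟨⟨_, mem_signedSet _ x⟩, hX _⟩
    · refine Or.inl ⟨⟨_, mem_signedSet _ a⟩⁻¹, ?_⟩
      rw [r.ofL_inv, hA, ← inv_inv g, ← h]; rfl
    · refine Or.inr ⟨⟨_, mem_signedSet _ x⟩⁻¹, ?_⟩
      rw [r.ofM_inv, hX, ← inv_inv g, ← h]; rfl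
  · rintro (⟨⟨_, a, rfl | rfl⟩, rfl⟩ | ⟨⟨_, x, rfl | rfl⟩, rfl⟩)
    · exact Or.inl ⟨Sum.inl a, (hA ⟨_, mem_signedSet _ a⟩).symm⟩
    · exact Or.inr ⟨Sum.inl a, by rw [hA, map_inv, inv_inv]; rfl⟩
    · exact Or.inl ⟨Sum.inr x, (hX ⟨_, mem_signedSet _ x⟩).symm⟩
    · exact Or.inr ⟨Sum.inr x, by rw [hX, map_inv, inv_inv]; rfl⟩

end Letters

/-! ### Normal forms in the group of the relators of length two -/

section NormalForm

variable {A X : Type*} {R : Set (FreeGroup (A ⊕ X))}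

/-- Reduced words in the letters, viewed in `⟨A ∪ X | R₂⟩`, are determined by their product. -/
theorem eq_of_prod_eq {v w : List (PresentedGroup (relatorsTwo R))}
    (hv : ∀ l ∈ v, l ∈ signedSet (PresentedGroup.of : A ⊕ X → PresentedGroup (relatorsTwo R)))
    (hw : ∀ l ∈ w, l ∈ signedSet (PresentedGroup.of : A ⊕ X → PresentedGroup (relatorsTwo R)))
    (hv' : v.IsChain fun l l' => l' ≠ l⁻¹) (hw' : w.IsChain fun l l' => l' ≠ l⁻¹)
    (h : v.prod = w.prod) : v = w := by
  let Y := signedSet (PresentedGroup.of : A ⊕ X → PresentedGroup (relatorsTwo R))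
  let F : PresentedGroup (relatorsTwo R) →* WordGroup Y :=
    PresentedGroup.toGroup (f := fun t => gen ⟨PresentedGroup.of t, mem_signedSet _ t⟩) (by
      rintro _ ⟨hr, t, rfl⟩
      rw [map_pow, FreeGroup.lift_apply_of, sq, ← eq_inv_iff_mul_eq_one, ← gen_inv]
      exact congrArg gen (Subtype.ext ((of_eq_inv_iff t).2 hr)))
  have hF : ∀ l : Y, F l = gen l := by
    rintro ⟨_, t, rfl | rfl⟩
    · exact PresentedGroup.toGroup.of _
    · rw [map_inv, PresentedGroup.toGroup.of, ← gen_inv]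
      rfl
  lift v to List Y using hv
  lift w to List Y using hw
  have hcoe : ∀ u : List Y, (u.map Subtype.val).IsChain (fun l l' => l' ≠ l⁻¹) → Reduced u := by
    intro u hu
    rw [List.isChain_map] at hu
    exact hu.imp fun l l' hl h => hl (by rw [h]; rfl)
  have hprod : ∀ u : List Y, F (u.map Subtype.val).prod = (u.map gen).prod := by
    intro u
    rw [map_list_prod, List.map_map]
    congr 2
    ext1 l
    exact hF l
  have : normalForm (F (v.map Subtype.val).prod) = normalForm (F (w.map Subtype.val).prod) := by
    rw [h]
  rw [hprod, hprod, normalForm_prod (hcoe _ hv'), normalForm_prod (hcoe _ hw')] at this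
  rw [this]

theorem letterA_mem (a : LetterA R) :
    (a : PresentedGroup (relatorsTwo R)) ∈ signedSet PresentedGroup.of := by
  obtain ⟨_, a, rfl | rfl⟩ := a
  · exact ⟨Sum.inl a, Or.inl rfl⟩
  · exact ⟨Sum.inl a, Or.inr rfl⟩

theorem letterX_mem (x : LetterX R) :
    (x : PresentedGroup (relatorsTwo R)) ∈ signedSet PresentedGroup.of := by
  obtain ⟨_, x, rfl | rfl⟩ := x
  · exact ⟨Sum.inr x, Or.inl rfl⟩
  · exact ⟨Sum.inr x, Or.inr rfl⟩

theorem letterX_ne_letterA (a : LetterA R) (x : LetterX R) :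
    (x : PresentedGroup (relatorsTwo R)) ≠ a := by
  obtain ⟨_, a, rfl | rfl⟩ := a <;> obtain ⟨_, x, rfl | rfl⟩ := x <;> intro h
  · simpa using eq_of_of_eq (Or.inl h)
  · simpa using eq_of_of_eq (Or.inr h.symm)
  · simpa using eq_of_of_eq (Or.inr h)
  · simpa using eq_of_of_eq (Or.inl (inv_injective h))

theorem isChain_square (a a' : LetterA R) (x x' : LetterX R) :
    [a.1, x.1, a'.1, x'.1].IsChain fun l l' => l' ≠ l⁻¹ := by
  simp only [List.isChain_cons_cons, List.isChain_singleton, and_true]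
  exact ⟨letterX_ne_letterA a⁻¹ x, (letterX_ne_letterA a' x⁻¹).symm, letterX_ne_letterA a'⁻¹ x'⟩

theorem mul_four_ne_one (a a' : LetterA R) (x x' : LetterX R) :
    (a * x * a' * x' : PresentedGroup (relatorsTwo R)) ≠ 1 := by
  intro h
  have := eq_of_prod_eq (v := [a.1, x.1, a'.1, x'.1]) (w := [])
    (by simp [letterA_mem, letterX_mem]) (by simp) (isChain_square a a' x x') List.isChain_nil
    (by simpa [mul_assoc] using h)
  simp at this

theorem mul_four_eq {a a' b b' : LetterA R} {x x' y y' : LetterX R}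
    (h : (a * x * a' * x' : PresentedGroup (relatorsTwo R)) = b * y * b' * y') :
    a = b ∧ a' = b' := by
  have := eq_of_prod_eq (v := [a.1, x.1, a'.1, x'.1]) (w := [b.1, y.1, b'.1, y'.1])
    (by simp [letterA_mem, letterX_mem]) (by simp [letterA_mem, letterX_mem])
    (isChain_square a a' x x') (isChain_square b b' y y') (by simpa [mul_assoc] using h)
  simp only [List.cons.injEq, Subtype.coe_inj] at this
  exact ⟨this.1, this.2.2.1⟩

/-- The relators in `R₄` are products of four letters. -/
theorem exists_letters_of_mem {g : PresentedGroup (relatorsTwo R)} (hg : g ∈ relatorsFourImage R) :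
    ∃ (a : LetterA R) (x : LetterX R) (a' : LetterA R) (x' : LetterX R), g = a * x * a' * x' := by
  obtain ⟨r, ⟨-, a, ha, x, hx, a', ha', x', hx', rfl⟩, rfl⟩ := hg
  have hA : ∀ a ∈ signedSet (fun a : A => FreeGroup.of (Sum.inl a : A ⊕ X)),
      PresentedGroup.mk (relatorsTwo R) a ∈
        signedSet (fun a : A => PresentedGroup.of (Sum.inl a)) :=
    fun a ha => map_mem_signedSet (f' := fun a : A => PresentedGroup.of (Sum.inl a)) _ id
      (fun _ => rfl) ha
  have hX : ∀ x ∈ signedSet (fun x : X => FreeGroup.of (Sum.inr x : A ⊕ X)),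
      PresentedGroup.mk (relatorsTwo R) x ∈
        signedSet (fun x : X => PresentedGroup.of (Sum.inr x)) :=
    fun x hx => map_mem_signedSet (f' := fun x : X => PresentedGroup.of (Sum.inr x)) _ id
      (fun _ => rfl) hx
  exact ⟨⟨_, hA a ha⟩, ⟨_, hX x hx⟩, ⟨_, hA a' ha'⟩, ⟨_, hX x' hx'⟩, by simp⟩

end NormalForm

/-! ### The doubled presentation -/

section Doubled

variable {A X : Type*} {R : Set (FreeGroup (A ⊕ X))}

/-- The two inclusions `origGen` and `barGen` of the generators, indexed by `Bool`. -/
def copyGen (c : Bool) : A ⊕ X → (A ⊕ A) ⊕ X := bif c then barGen else origGen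

/-- The map `A ∪ Ā ∪ X → A ∪ X` with `a ↦ a`, `ā ↦ a` and `x ↦ x`. -/
def foldGen : (A ⊕ A) ⊕ X → A ⊕ X := Sum.map (Sum.elim id id) id

@[simp]
theorem foldGen_copyGen (c : Bool) (t : A ⊕ X) : foldGen (copyGen c t) = t := by
  cases c <;> cases t <;> rfl

theorem exists_copyGen (t : (A ⊕ A) ⊕ X) : ∃ c s, t = copyGen c s := by
  rcases t with (a | a) | x
  · exact ⟨false, Sum.inl a, rfl⟩
  · exact ⟨true, Sum.inl a, rfl⟩
  · exact ⟨false, Sum.inr x, rfl⟩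

theorem exists_of_mem_doubleRelators {d : FreeGroup ((A ⊕ A) ⊕ X)} (hd : d ∈ doubleRelators R) :
    ∃ c, ∃ r ∈ R, d = FreeGroup.map (copyGen c) r := by
  rcases hd with ⟨r, hr, rfl⟩ | ⟨a, ha, rfl⟩ | ⟨r, hr, rfl⟩
  · exact ⟨false, r, hr, rfl⟩
  · exact ⟨true, _, ha, by simp [copyGen, barGen]⟩
  · exact ⟨true, r, hr.1, rfl⟩

theorem map_copyGen_mem (hR : IsBMWPresentation R) (c : Bool) {r : FreeGroup (A ⊕ X)}
    (hr : r ∈ R) : FreeGroup.map (copyGen c) r ∈ doubleRelators R := by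
  cases c
  · exact Or.inl ⟨r, hr, rfl⟩
  · exact mapsTo_bar hR hr

theorem map_copyGen_mem_relatorsFour (hR : IsBMWPresentation R) (c : Bool)
    {r : FreeGroup (A ⊕ X)} (hr : r ∈ relatorsFour R) :
    FreeGroup.map (copyGen c) r ∈ relatorsFour (doubleRelators R) := by
  obtain ⟨hr, b, hb, y, hy, b', hb', y', hy', rfl⟩ := hr
  have hA : ∀ b ∈ signedSet (fun a : A => FreeGroup.of (Sum.inl a : A ⊕ X)),
      FreeGroup.map (copyGen c) b ∈
        signedSet (fun a : A ⊕ A => FreeGroup.of (Sum.inl a : (A ⊕ A) ⊕ X)) := fun b hb =>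
    map_mem_signedSet _ (bif c then Sum.inr else Sum.inl) (fun a => by
      rw [FreeGroup.map.of]; cases c <;> rfl) hb
  have hX : ∀ y ∈ signedSet (fun x : X => FreeGroup.of (Sum.inr x : A ⊕ X)),
      FreeGroup.map (copyGen c) y ∈
        signedSet (fun x : X => FreeGroup.of (Sum.inr x : (A ⊕ A) ⊕ X)) := fun y hy =>
    map_mem_signedSet _ id (fun a => by rw [FreeGroup.map.of]; cases c <;> rfl) hy
  exact ⟨map_copyGen_mem hR c hr, _, hA b hb, _, hX y hy, _, hA b' hb', _, hX y' hy',
    by simp only [map_mul]⟩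

theorem map_foldGen_mem {d : FreeGroup ((A ⊕ A) ⊕ X)} (hd : d ∈ doubleRelators R) :
    FreeGroup.map foldGen d ∈ R := by
  obtain ⟨c, r, hr, rfl⟩ := exists_of_mem_doubleRelators hd
  rw [FreeGroup.map.comp, show (foldGen ∘ copyGen c : A ⊕ X → A ⊕ X) = id from
    funext (foldGen_copyGen c), FreeGroup.map.id]
  exact hr

theorem sq_mem_doubleRelators (hR : IsBMWPresentation R) (t : (A ⊕ A) ⊕ X) :
    FreeGroup.of t ^ 2 ∈ doubleRelators R ↔ FreeGroup.of (foldGen t) ^ 2 ∈ R := by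
  constructor
  · intro h
    simpa using map_foldGen_mem h
  · intro h
    obtain ⟨c, s, rfl⟩ := exists_copyGen t
    rw [foldGen_copyGen] at h
    simpa using map_copyGen_mem hR c h

theorem degreeA_doubleRelators [Finite A] (hR : IsBMWPresentation R) :
    degreeA (doubleRelators R) = 2 * degreeA R := by
  have key : ∀ p : A → Prop,
      {a : A ⊕ A | p (Sum.elim id id a)}.ncard = 2 * {a : A | p a}.ncard := by
    intro p
    have : {a : A ⊕ A | p (Sum.elim id id a)} = Sum.inl '' {a | p a} ∪ Sum.inr '' {a | p a} := by
      ext (a | a) <;> simp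
    rw [this, Set.ncard_union_eq (by
      rw [Set.disjoint_left]; rintro _ ⟨a, -, rfl⟩ ⟨b, -, h⟩; cases h),
      Set.ncard_image_of_injective _ Sum.inl_injective,
      Set.ncard_image_of_injective _ Sum.inr_injective, two_mul]
  simp only [degreeA, sq_mem_doubleRelators hR]
  have h1 := key fun a => FreeGroup.of (Sum.inl a) ^ 2 ∈ R
  have h2 := key fun a => FreeGroup.of (Sum.inl a) ^ 2 ∉ R
  simp only [foldGen, Sum.map_inl]
  rw [h1, h2]
  ring

theorem degreeX_doubleRelators (hR : IsBMWPresentation R) :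
    degreeX (doubleRelators R) = degreeX R := by
  simp only [degreeX, sq_mem_doubleRelators hR, foldGen, Sum.map_inr, id]

variable (R) in
/-- The homomorphism from the group of the relators of length two of the doubled presentation that
identifies the two copies of `A`. -/
def foldHom : PresentedGroup (relatorsTwo (doubleRelators R)) →* PresentedGroup (relatorsTwo R) :=
  PresentedGroup.map (FreeGroup.map foldGen) (by
    rintro _ ⟨hr, t, rfl⟩
    exact ⟨map_foldGen_mem hr, foldGen t, by simp⟩)

/-- The two inclusions of the group of the relators of length two, indexed by `Bool`. -/
def copyHom (hR : IsBMWPresentation R) (c : Bool) :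
    PresentedGroup (relatorsTwo R) →* PresentedGroup (relatorsTwo (doubleRelators R)) :=
  PresentedGroup.map (FreeGroup.map (copyGen c)) (by
    rintro _ ⟨hr, t, rfl⟩
    exact ⟨map_copyGen_mem hR c hr, copyGen c t, by simp⟩)

theorem foldHom_of (t : (A ⊕ A) ⊕ X) :
    foldHom R (PresentedGroup.of t) = PresentedGroup.of (foldGen t) :=
  congrArg (PresentedGroup.mk _) (FreeGroup.map.of (f := foldGen))

theorem copyHom_of (hR : IsBMWPresentation R) (c : Bool) (t : A ⊕ X) :
    copyHom hR c (PresentedGroup.of t) = PresentedGroup.of (copyGen c t) :=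
  congrArg (PresentedGroup.mk _) (FreeGroup.map.of (f := copyGen c))

@[simp]
theorem foldHom_copyHom (hR : IsBMWPresentation R) (c : Bool) (g : PresentedGroup (relatorsTwo R)) :
    foldHom R (copyHom hR c g) = g := by
  have : (foldHom R).comp (copyHom hR c) = MonoidHom.id _ := PresentedGroup.ext fun t => by
    simp [copyHom_of, foldHom_of]
  exact DFunLike.congr_fun this g

theorem copyHom_mem_letterA (hR : IsBMWPresentation R) (c : Bool) (a : LetterA R) :
    copyHom hR c a ∈ signedSet (fun a : A ⊕ A =>
      (PresentedGroup.of (Sum.inl a) : PresentedGroup (relatorsTwo (doubleRelators R)))) :=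
  map_mem_signedSet _ (bif c then Sum.inr else Sum.inl) (fun a => by
    rw [copyHom_of]; cases c <;> rfl) a.2

theorem copyHom_mem_letterX (hR : IsBMWPresentation R) (c : Bool) (x : LetterX R) :
    copyHom hR c x ∈ signedSet (fun x : X =>
      (PresentedGroup.of (Sum.inr x) : PresentedGroup (relatorsTwo (doubleRelators R)))) :=
  map_mem_signedSet _ id (fun a => by rw [copyHom_of]; cases c <;> rfl) x.2

theorem exists_eq_copyHom (hR : IsBMWPresentation R) (a : LetterA (doubleRelators R)) :
    ∃ (c : Bool) (b : LetterA R), (a : PresentedGroup _) = copyHom hR c b := by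
  obtain ⟨_, a | a, rfl | rfl⟩ := a
  · exact ⟨false, ⟨_, mem_signedSet _ a⟩, (copyHom_of hR false (Sum.inl a)).symm⟩
  · exact ⟨false, ⟨_, mem_signedSet _ a⟩⁻¹, by
      rw [signedSet.coe_inv, map_inv, copyHom_of]; rfl⟩
  · exact ⟨true, ⟨_, mem_signedSet _ a⟩, (copyHom_of hR true (Sum.inl a)).symm⟩
  · exact ⟨true, ⟨_, mem_signedSet _ a⟩⁻¹, by
      rw [signedSet.coe_inv, map_inv, copyHom_of]; rfl⟩

/-- The two copies of the letters in `A` are disjoint. -/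
theorem eq_of_copyHom_eq (hR : IsBMWPresentation R) {c d : Bool} {a b : LetterA R}
    (h : copyHom hR c a = copyHom hR d b) : c = d := by
  have key : ∀ s t, (copyHom hR c (PresentedGroup.of (Sum.inl s)) =
      copyHom hR d (PresentedGroup.of (Sum.inl t)) ∨
      copyHom hR c (PresentedGroup.of (Sum.inl s)) =
      (copyHom hR d (PresentedGroup.of (Sum.inl t)))⁻¹) → c = d := by
    intro s t h
    rw [copyHom_of, copyHom_of] at h
    have := eq_of_of_eq h
    revert this
    cases c <;> cases d <;> simp [copyGen, barGen, origGen]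
  obtain ⟨_, a, rfl | rfl⟩ := a <;> obtain ⟨_, b, rfl | rfl⟩ := b
  · exact key a b (Or.inl h)
  · exact key a b (Or.inr (by rw [h, map_inv]))
  · exact key a b (Or.inr (by rw [← h, map_inv, inv_inv]))
  · exact key a b (Or.inl (by simpa using h))

theorem copyHom_foldHom_letterX (hR : IsBMWPresentation R) (c : Bool)
    (x : LetterX (doubleRelators R)) : copyHom hR c (foldHom R x) = x := by
  obtain ⟨_, x, rfl | rfl⟩ := x
  · rw [foldHom_of, copyHom_of]; cases c <;> rfl
  · rw [map_inv, map_inv, foldHom_of, copyHom_of]; cases c <;> rfl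

theorem foldHom_mem_letterX (x : LetterX (doubleRelators R)) :
    foldHom R x ∈ signedSet (fun x : X =>
      (PresentedGroup.of (Sum.inr x) : PresentedGroup (relatorsTwo R))) :=
  map_mem_signedSet _ id (fun _ => foldHom_of _) x.2

theorem mem_relatorsFourImage_double (hR : IsBMWPresentation R)
    {a a' : LetterA (doubleRelators R)} {x x' : LetterX (doubleRelators R)} :
    a.1 * x.1 * a'.1 * x'.1 ∈ relatorsFourImage (doubleRelators R) ↔
      ∃ c, ∃ r ∈ relatorsFourImage R, a.1 * x.1 * a'.1 * x'.1 = copyHom hR c r := by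
  constructor
  · rintro ⟨d, hd, hda⟩
    obtain ⟨c, r, hr, rfl⟩ := exists_of_mem_doubleRelators hd.1
    refine ⟨c, PresentedGroup.mk _ r, ⟨r, (hR.1 r hr).resolve_left fun h2 => ?_, rfl⟩, hda.symm⟩
    -- a square of a generator is trivial in the group, but a product of four letters is not
    refine mul_four_ne_one a a' x x' ?_
    rw [← hda]
    change copyHom hR c (PresentedGroup.mk _ r) = 1
    rw [PresentedGroup.one_of_mem h2, map_one]
  · rintro ⟨c, _, ⟨r, hr, rfl⟩, h⟩
    exact ⟨_, map_copyGen_mem_relatorsFour hR c hr, h.symm⟩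

/-- A relator of the doubled presentation involves only one of the two copies of `A`. -/
theorem mem_relatorsFourImage_copy (hR : IsBMWPresentation R) {c d : Bool} {a a' : LetterA R}
    {x x' : LetterX (doubleRelators R)} :
    copyHom hR c a * x * copyHom hR d a' * x' ∈ relatorsFourImage (doubleRelators R) ↔
      c = d ∧ a * foldHom R x * a' * foldHom R x' ∈ relatorsFourImage R := by
  rw [mem_relatorsFourImage_double hR (a := ⟨_, copyHom_mem_letterA hR c a⟩)
    (a' := ⟨_, copyHom_mem_letterA hR d a'⟩)]
  constructor
  · rintro ⟨e, r, hr, h⟩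
    obtain ⟨b, y, b', y', hr'⟩ := exists_letters_of_mem hr
    have h1 := h
    rw [hr', map_mul, map_mul, map_mul] at h1
    obtain ⟨hb, hb'⟩ := mul_four_eq (b := ⟨_, copyHom_mem_letterA hR e b⟩)
      (b' := ⟨_, copyHom_mem_letterA hR e b'⟩) (y := ⟨_, copyHom_mem_letterX hR e y⟩)
      (y' := ⟨_, copyHom_mem_letterX hR e y'⟩) h1
    refine ⟨(eq_of_copyHom_eq hR (congrArg Subtype.val hb)).trans
      (eq_of_copyHom_eq hR (congrArg Subtype.val hb')).symm, ?_⟩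
    have h2 := congrArg (foldHom R) h
    simp only [map_mul, foldHom_copyHom] at h2
    rwa [h2]
  · rintro ⟨rfl, h⟩
    exact ⟨c, _, h, by simp only [map_mul, copyHom_foldHom_letterX]⟩

theorem formsSquare_copy (hR : IsBMWPresentation R) {c d : Bool} {a a' : LetterA R}
    {x x' : LetterX (doubleRelators R)} :
    FormsSquare (doubleRelators R) (copyHom hR c a) x (copyHom hR d a') x' ↔
      c = d ∧ FormsSquare R a (foldHom R x) a' (foldHom R x') := by
  have h1 := mem_relatorsFourImage_copy hR (c := c) (d := d) (a := a) (a' := a') (x := x) (x' := x')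
  have h2 := mem_relatorsFourImage_copy hR (c := d) (d := c) (a := a') (a' := a) (x := x') (x' := x)
  have h3 := mem_relatorsFourImage_copy hR (c := c) (d := d) (a := a⁻¹) (a' := a'⁻¹) (x := x'⁻¹)
    (x' := x⁻¹)
  have h4 := mem_relatorsFourImage_copy hR (c := d) (d := c) (a := a'⁻¹) (a' := a⁻¹) (x := x⁻¹)
    (x' := x'⁻¹)
  simp only [signedSet.coe_inv, map_inv] at h3 h4
  unfold FormsSquare
  rw [h1, h2, h3, h4, eq_comm (a := d), ← and_or_left, ← and_or_left, ← and_or_left]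

theorem isBMWPresentation_doubleRelators (hR : IsBMWPresentation R) :
    IsBMWPresentation (doubleRelators R) := by
  constructor
  · intro d hd
    obtain ⟨c, r, hr, rfl⟩ := exists_of_mem_doubleRelators hd
    rcases hR.1 r hr with ⟨-, t, rfl⟩ | h4
    · exact Or.inl ⟨hd, copyGen c t, by simp⟩
    · exact Or.inr (map_copyGen_mem_relatorsFour hR c h4)
  · intro a ha x hx
    lift a to LetterA (doubleRelators R) using ha
    lift x to LetterX (doubleRelators R) using hx
    obtain ⟨c, b, hb⟩ := exists_eq_copyHom hR a
    obtain ⟨p, hp, huniq⟩ := hR.existsUnique_corner b ⟨foldHom R x, foldHom_mem_letterX x⟩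
    rw [hb]
    refine ⟨(copyHom hR c p.1, copyHom hR c p.2), ⟨copyHom_mem_letterA hR c p.1,
      copyHom_mem_letterX hR c p.2, ?_⟩, ?_⟩
    · refine (formsSquare_copy hR (x' := ⟨_, copyHom_mem_letterX hR c p.2⟩)).2 ⟨rfl, ?_⟩
      rw [foldHom_copyHom]
      exact hp
    · rintro ⟨q, y⟩ ⟨hq, hy, h⟩
      simp only at hq hy h
      lift q to LetterA (doubleRelators R) using hq
      lift y to LetterX (doubleRelators R) using hy
      obtain ⟨d, q', hq'⟩ := exists_eq_copyHom hR q
      rw [hq'] at h ⊢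
      obtain ⟨rfl, hsq⟩ := (formsSquare_copy hR).1 h
      have := huniq (q', ⟨foldHom R y, foldHom_mem_letterX y⟩) hsq
      rw [← this]
      exact Prod.ext rfl (copyHom_foldHom_letterX hR c y).symm

end Doubled

/-! ### The double as an amalgamated product -/

section Amalgam

variable {A X : Type*} {R : Set (FreeGroup (A ⊕ X))}

theorem origHom_of (t : A ⊕ X) :
    origHom R (PresentedGroup.of t) = PresentedGroup.of (origGen t) :=
  congrArg (PresentedGroup.mk _) (FreeGroup.map.of (f := origGen))

theorem barHom_of (hR : IsBMWPresentation R) (t : A ⊕ X) :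
    barHom hR (PresentedGroup.of t) = PresentedGroup.of (barGen t) :=
  congrArg (PresentedGroup.mk _) (FreeGroup.map.of (f := barGen))

theorem origHom_eq_barHom (hR : IsBMWPresentation R) {g : PresentedGroup R}
    (hg : g ∈ subgroupX R) : origHom R g = barHom hR g := by
  have : subgroupX R ≤ (origHom R).eqLocus (barHom hR) := by
    rw [subgroupX, Subgroup.closure_le]
    rintro _ ⟨x, rfl⟩
    change origHom R _ = barHom hR _
    rw [origHom_of, barHom_of]
    rfl
  exact this hg

theorem of_false_eq_of_true {g : PresentedGroup R} (hg : g ∈ subgroupX R) :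
    (Monoid.PushoutI.of false g : DoubleOverX R) = Monoid.PushoutI.of true g := by
  have h := Monoid.PushoutI.of_apply_eq_base (fun _ : Bool => (subgroupX R).subtype)
  exact (h false ⟨g, hg⟩).trans (h true ⟨g, hg⟩).symm

/-- Elements outside `⟨X⟩` are different in the two factors of the amalgamated product. -/
theorem mem_subgroupX_of_eq {g : PresentedGroup R}
    (hg : (Monoid.PushoutI.of false g : DoubleOverX R) = Monoid.PushoutI.of true g) :
    g ∈ subgroupX R := by
  have hinj : ∀ _ : Bool, Function.Injective (subgroupX R).subtype :=
    fun _ => (subgroupX R).subtype_injective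
  have hmem : (Monoid.PushoutI.of false g : DoubleOverX R) ∈
      (Monoid.PushoutI.base fun _ : Bool => (subgroupX R).subtype).range := by
    rw [← Monoid.PushoutI.inf_of_range_eq_base_range hinj (i := false) (j := true) (by decide)]
    exact ⟨⟨g, rfl⟩, ⟨g, hg.symm⟩⟩
  obtain ⟨h, hh⟩ := hmem
  rw [← Monoid.PushoutI.of_apply_eq_base _ false] at hh
  rw [← Monoid.PushoutI.of_injective hinj false hh]
  exact h.2

/-- The images of the generators of the doubled presentation in the amalgamated product. -/
def amalgamGen : (A ⊕ A) ⊕ X → DoubleOverX R :=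
  Sum.elim (Sum.elim (fun a => Monoid.PushoutI.of false (PresentedGroup.of (Sum.inl a)))
      fun a => Monoid.PushoutI.of true (PresentedGroup.of (Sum.inl a)))
    fun x => Monoid.PushoutI.of false (PresentedGroup.of (Sum.inr x))

theorem amalgamGen_copyGen (c : Bool) (t : A ⊕ X) :
    (amalgamGen (copyGen c t) : DoubleOverX R) = Monoid.PushoutI.of c (PresentedGroup.of t) := by
  rcases c with _ | _ <;> rcases t with a | x
  · rfl
  · rfl
  · rfl
  · exact of_false_eq_of_true (Subgroup.subset_closure ⟨x, rfl⟩)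

theorem lift_amalgamGen_copy (c : Bool) (r : FreeGroup (A ⊕ X)) :
    FreeGroup.lift (amalgamGen (R := R)) (FreeGroup.map (copyGen c) r) =
      Monoid.PushoutI.of c (PresentedGroup.mk R r) := by
  have : (FreeGroup.lift (amalgamGen (R := R))).comp (FreeGroup.map (copyGen c)) =
      (Monoid.PushoutI.of (φ := fun _ : Bool => (subgroupX R).subtype) c).comp
        (PresentedGroup.mk R) := FreeGroup.ext_hom _ _ fun t => by
    rw [MonoidHom.comp_apply, FreeGroup.map.of, FreeGroup.lift_apply_of, amalgamGen_copyGen]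
    rfl
  exact DFunLike.congr_fun this r

variable (R) in
/-- The homomorphism from the group of the doubled presentation to the amalgamated product. -/
def toAmalgam : PresentedGroup (doubleRelators R) →* DoubleOverX R :=
  PresentedGroup.toGroup (f := amalgamGen) (by
    intro d hd
    obtain ⟨c, r, hr, rfl⟩ := exists_of_mem_doubleRelators hd
    rw [lift_amalgamGen_copy, PresentedGroup.one_of_mem hr, map_one])

theorem toAmalgam_of (t : (A ⊕ A) ⊕ X) : toAmalgam R (PresentedGroup.of t) = amalgamGen t :=
  PresentedGroup.toGroup.of _

theorem toAmalgam_origHom (g : PresentedGroup R) :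
    toAmalgam R (origHom R g) = Monoid.PushoutI.of false g := by
  have : (toAmalgam R).comp (origHom R) =
      Monoid.PushoutI.of (φ := fun _ : Bool => (subgroupX R).subtype) false :=
    PresentedGroup.ext fun t => by
      rw [MonoidHom.comp_apply, origHom_of, toAmalgam_of]
      exact amalgamGen_copyGen false t
  exact DFunLike.congr_fun this g

theorem toAmalgam_barHom (hR : IsBMWPresentation R) (g : PresentedGroup R) :
    toAmalgam R (barHom hR g) = Monoid.PushoutI.of true g := by
  have : (toAmalgam R).comp (barHom hR) =
      Monoid.PushoutI.of (φ := fun _ : Bool => (subgroupX R).subtype) true :=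
    PresentedGroup.ext fun t => by
      rw [MonoidHom.comp_apply, barHom_of, toAmalgam_of]
      exact amalgamGen_copyGen true t
  exact DFunLike.congr_fun this g

/-- The homomorphism from the amalgamated product to the group of the doubled presentation. -/
def ofAmalgam (hR : IsBMWPresentation R) :
    DoubleOverX R →* PresentedGroup (doubleRelators R) :=
  Monoid.PushoutI.lift (fun c => bif c then barHom hR else origHom R)
    ((origHom R).comp (subgroupX R).subtype) (by
      rintro (_ | _)
      · rfl
      · exact MonoidHom.ext fun x => (origHom_eq_barHom hR x.2).symm)

theorem ofAmalgam_of (hR : IsBMWPresentation R) (c : Bool) (g : PresentedGroup R) :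
    ofAmalgam hR (Monoid.PushoutI.of c g) = (bif c then barHom hR else origHom R) g := by
  unfold ofAmalgam
  rw [Monoid.PushoutI.lift_of]

/-- The group of the doubled presentation is the amalgamated product. -/
def amalgamEquiv (hR : IsBMWPresentation R) :
    PresentedGroup (doubleRelators R) ≃* DoubleOverX R :=
  (toAmalgam R).toMulEquiv (ofAmalgam hR)
    (PresentedGroup.ext fun t => by
      obtain ⟨c, s, rfl⟩ := exists_copyGen t
      rw [MonoidHom.comp_apply, toAmalgam_of, amalgamGen_copyGen]
      cases c
      · rw [ofAmalgam_of, cond_false, origHom_of]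
        rfl
      · rw [ofAmalgam_of, cond_true, barHom_of]
        rfl)
    (Monoid.PushoutI.hom_ext_nonempty fun c => MonoidHom.ext fun x => by
      rw [MonoidHom.comp_apply, MonoidHom.comp_apply]
      cases c
      · rw [ofAmalgam_of, cond_false, toAmalgam_origHom]
        rfl
      · rw [ofAmalgam_of, cond_true, toAmalgam_barHom]
        rfl)

/-! ### The finite residual of the double -/

variable (R) in
/-- The set `A ∪ A⁻¹` in `⟨A ∪ X | R⟩` consists of the images of the letters. -/
theorem quotientTwo_mem_signedSet (a : LetterA R) :
    quotientTwo R a ∈ signedSet (fun a : A => (PresentedGroup.of (Sum.inl a) : PresentedGroup R)) :=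
  map_mem_signedSet (f' := fun a : A => PresentedGroup.of (Sum.inl a)) (quotientTwo R) id
    (fun _ => rfl) a.2

theorem homM_mem_subgroupX {hR : IsBMWPresentation R}
    {r : Realization hR.squareData (PresentedGroup R)} (hX : ∀ x, r.ofM x = quotientTwo R x)
    (v : WordGroup (LetterX R)) : r.homM v ∈ subgroupX R := by
  induction v using induction_left with
  | one => rw [map_one]; exact one_mem _
  | mul x v ih =>
    rw [map_mul, r.homM_gen, hX]
    refine mul_mem ?_ ih
    obtain ⟨_, x, rfl | rfl⟩ := x
    · exact Subgroup.subset_closure ⟨x, rfl⟩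
    · rw [map_inv]
      exact inv_mem (Subgroup.subset_closure ⟨x, rfl⟩)

/-- The subgroup `⟨X⟩` fixes the base vertex of the first tree. -/
theorem left_one_of_mem_subgroupX {hR : IsBMWPresentation R}
    {r : Realization hR.squareData (PresentedGroup R)} (hX : ∀ x, r.ofM x = quotientTwo R x)
    {g : PresentedGroup R} (hg : g ∈ subgroupX R) : r.left g 1 = 1 := by
  have : subgroupX R ≤ (MulAction.stabilizer (Equiv.Perm (WordGroup (LetterA R)))
      (1 : WordGroup (LetterA R))).comap r.left := by
    rw [subgroupX, Subgroup.closure_le]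
    rintro _ ⟨x, rfl⟩
    have h := r.left_homM_one (gen ⟨_, mem_signedSet _ x⟩)
    rw [r.homM_gen, hX] at h
    exact h
  exact this hg

/-- The double of an irreducible group has elements of the form `a b⁻¹ b̄ ā⁻¹` with `a ≠ b` in its
finite residual: if each of them were avoided by a finite index subgroup, then intersecting the
preimages of these subgroups in the two factors would give a finite index normal subgroup of
`⟨A ∪ X | R⟩` that separates the generators modulo `⟨X⟩`. -/
theorem exists_mem_finite_residual [Finite A] [Finite X] (hR : IsBMWPresentation R)
    (hA : 2 ≤ degreeA R) (hX : 2 ≤ degreeX R) (hirr : ¬ IsReducible (PresentedGroup R)) :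
    ∃ a b : LetterA R, a ≠ b ∧
      ∀ H : Subgroup (PresentedGroup (doubleRelators R)), H.FiniteIndex →
        origHom R (quotientTwo R a) * (origHom R (quotientTwo R b))⁻¹ *
          barHom hR (quotientTwo R b) * (barHom hR (quotientTwo R a))⁻¹ ∈ H := by
  by_contra hcon
  push Not at hcon
  obtain ⟨r, hrA, hrX⟩ := hR.exists_realization
  have : Nontrivial (LetterA R) := by
    rw [← Finite.one_lt_card_iff_nontrivial, card_letterA]; exact hA
  have : Nontrivial (LetterX R) := by
    rw [← Finite.one_lt_card_iff_nontrivial, card_letterX]; exact hX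
  have hcon' : ∀ a b : LetterA R, ∃ H : Subgroup (PresentedGroup (doubleRelators R)),
      H.FiniteIndex ∧ (a ≠ b → origHom R (quotientTwo R a) * (origHom R (quotientTwo R b))⁻¹ *
          barHom hR (quotientTwo R b) * (barHom hR (quotientTwo R a))⁻¹ ∉ H) := by
    intro a b
    by_cases hab : a = b
    · exact ⟨⊤, inferInstance, fun h => absurd hab h⟩
    · obtain ⟨H, hH, hn⟩ := hcon a b hab
      exact ⟨H, hH, fun _ => hn⟩
  choose H hH hn using hcon'
  let N : Subgroup (PresentedGroup R) := ⨅ p : LetterA R × LetterA R,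
    (H p.1 p.2).normalCore.comap (origHom R) ⊓ (H p.1 p.2).normalCore.comap (barHom hR)
  have hNfin : N.FiniteIndex := by
    refine Subgroup.finiteIndex_iInf fun p => ?_
    have := hH p.1 p.2
    have h1 := finiteIndex_comap (origHom R) (H p.1 p.2).normalCore
    have h2 := finiteIndex_comap (barHom hR) (H p.1 p.2).normalCore
    infer_instance
  have hNnormal : N.Normal := Subgroup.normal_iInf_normal fun p => inferInstance
  refine hirr (r.isReducible_of_separates (N := N) fun a b hab v n hnN h => ?_)
  refine hn a⁻¹ b⁻¹ (fun h => hab (inv_injective h)) ((H a⁻¹ b⁻¹).normalCore_le ?_)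
  obtain ⟨hn1, hn2⟩ := Subgroup.mem_iInf.1 hnN (a⁻¹, b⁻¹)
  have hn1 : origHom R n ∈ (H a⁻¹ b⁻¹).normalCore := hn1
  have hn2 : barHom hR n ∈ (H a⁻¹ b⁻¹).normalCore := hn2
  have hv := origHom_eq_barHom hR (homM_mem_subgroupX hrX v)
  have h1 := congrArg (origHom R) h
  have h2 := congrArg (barHom hR) h
  rw [hrA, hrA] at h1 h2
  simp only [map_mul, map_inv] at h1 h2
  simp only [signedSet.coe_inv, map_inv, inv_inv]
  -- with `g = a⁻¹ b = h n`, the element is `g ḡ⁻¹ = h n n̄⁻¹ h⁻¹`, where `h` is in `⟨X⟩`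
  rw [h1, mul_assoc, show (barHom hR (quotientTwo R b))⁻¹ * barHom hR (quotientTwo R a) =
    ((barHom hR (quotientTwo R a))⁻¹ * barHom hR (quotientTwo R b))⁻¹ by group, h2, hv]
  have := (Subgroup.normalCore_normal (H a⁻¹ b⁻¹)).conj_mem _
    (mul_mem hn1 (inv_mem hn2)) (barHom hR (r.homM v))
  simpa [mul_assoc] using this

end Amalgam

end BMW

theorem mainTheorem4 {A : Type*} {X : Type*} [Finite A] [Finite X]
    (R : Set (FreeGroup (A ⊕ X))) (hR : BMW.IsBMWPresentation R)
    (m n : ℕ) (hm : BMW.degreeA R = m) (hn : BMW.degreeX R = n) (hm2 : 2 ≤ m) (hn2 : 2 ≤ n)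
    (hirr : ¬ BMW.IsReducible (PresentedGroup R)) :
    -- `Λ` is the double of `Γ` over `⟨X⟩`
    (∃ e : PresentedGroup (BMW.doubleRelators R) ≃* BMW.DoubleOverX R,
      ∀ g : PresentedGroup R,
        e (BMW.origHom R g) = Monoid.PushoutI.of false g ∧
        e (BMW.barHom hR g) = Monoid.PushoutI.of true g) ∧
    -- the doubled presentation is a BMW-presentation of degree `(2m, n)`
    BMW.IsBMWPresentation (BMW.doubleRelators R) ∧
    BMW.degreeA (BMW.doubleRelators R) = 2 * m ∧
    BMW.degreeX (BMW.doubleRelators R) = n ∧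
    -- `Λ` is a BMW-group of degree `(2m, n)`
    BMW.IsBMWGroup (PresentedGroup (BMW.doubleRelators R))
      (Set.range PresentedGroup.of) (2 * m) n ∧
    -- which is irreducible
    ¬ BMW.IsReducible (PresentedGroup (BMW.doubleRelators R)) ∧
    -- and not residually finite
    ¬ Group.ResiduallyFinite (PresentedGroup (BMW.doubleRelators R)) ∧
    -- an explicit element of the finite residual
    ∃ a ∈ BMW.signedSet (fun a : A => (PresentedGroup.of (Sum.inl a) : PresentedGroup R)),
      ∃ b ∈ BMW.signedSet (fun a : A => (PresentedGroup.of (Sum.inl a) : PresentedGroup R)),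
        a ≠ b ∧
        ∀ H : Subgroup (PresentedGroup (BMW.doubleRelators R)), H.FiniteIndex →
          BMW.origHom R a * (BMW.origHom R b)⁻¹ * BMW.barHom hR b * (BMW.barHom hR a)⁻¹ ∈ H := by
  subst hm hn
  have hD := BMW.isBMWPresentation_doubleRelators hR
  obtain ⟨a, b, hab, hmem⟩ := BMW.exists_mem_finite_residual hR hm2 hn2 hirr
  obtain ⟨r, hrA, hrX⟩ := hR.exists_realization
  have hnotRF : ¬ Group.ResiduallyFinite (PresentedGroup (BMW.doubleRelators R)) := by
    intro hRF
    have h1 := Group.residuallyFinite_iff_forall_finiteIndex.1 hRF _ fun H hH => hmem H hH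
    have h2 : BMW.origHom R (BMW.quotientTwo R a * (BMW.quotientTwo R b)⁻¹) =
        BMW.barHom hR (BMW.quotientTwo R a * (BMW.quotientTwo R b)⁻¹) := by
      rw [map_mul, map_mul, map_inv, map_inv, ← mul_inv_eq_one, ← h1]
      group
    have h3 := congrArg (BMW.toAmalgam R) h2
    rw [BMW.toAmalgam_origHom, BMW.toAmalgam_barHom] at h3
    have h4 := BMW.left_one_of_mem_subgroupX hrX (BMW.mem_subgroupX_of_eq h3)
    rw [← hrA, ← hrA, ← r.ofL_inv, map_mul, Equiv.Perm.mul_apply, r.left_ofL, r.left_ofL] at h4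
    simp only [Equiv.coe_mulLeft, mul_one, BMW.WordGroup.gen_inv, mul_inv_eq_one] at h4
    exact hab (BMW.WordGroup.gen_injective h4)
  refine ⟨⟨BMW.amalgamEquiv hR, fun g => ⟨BMW.toAmalgam_origHom g, BMW.toAmalgam_barHom hR g⟩⟩, hD,
    BMW.degreeA_doubleRelators hR, BMW.degreeX_doubleRelators hR, ?_,
    fun h => hnotRF h.residuallyFinite, hnotRF,
    BMW.quotientTwo R a, BMW.quotientTwo_mem_signedSet R a, BMW.quotientTwo R b, BMW.quotientTwo_mem_signedSet R b, ?_,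
    hmem⟩
  · rw [← BMW.degreeA_doubleRelators hR, ← BMW.degreeX_doubleRelators hR]
    exact hD.isBMWGroup
  · rw [← hrA, ← hrA]
    exact fun h => hab (r.ofL_injective h)
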